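/- **Setting.** Let $p$ be a prime, $k$ a field of characteristic $p$, $G$ a finite group with $p \mid |G|$, and $H\le G$ a subgroup of index prime to $p$. For a finite left $G$-set $X$, a representation $V$ of $X$ over $k$ consists of a $k$-vector space $V_x$ for every $x\in X$ and $k$-linear isomorphisms $V_g:V_x\to V_{gx}$ for all $g\in G$, $x\in X$, with $V_1=\mathrm{id}$ and $V_{g_2g_1}=V_{g_2}V_{g_1}$; morphisms are families of linear maps $V_x\to V'_x$ commuting with all $V_g,V'_g$. Let $\mathrm{Rep}(X)$ be the resulting abelian category and $\mathrm{StRep}(X)$ its stable category, i.e. the quotient by the morphisms that factor through a projective object. It is symmetric monoidal for $(V\otimes V')_x=V_x\otimes_k V'_x$, with unit $\mathbf 1$, $\mathbf 1_x=k$. A $G$-map $\alpha:Y\to X$ induces the $\otimes$-functor $\alpha^*:\mathrm{StRep}(X)\to\mathrm{StRep}(Y)$, $(\alpha^*V)_y=V_{\alpha(y)}$, and $\beta^*\alpha^*=(\alpha\beta)^*$. Define presheaves of abelian groups on finite $G$-sets: $\mathrm{StPic}(X)$ is the group of isomorphism classes of $\otimes$-invertible objects of $\mathrm{StRep}(X)$,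 and $\mathbb G_m(X)=\mathrm{Aut}_{\mathrm{StRep}(X)}(\mathbf 1)$. Let $U=G/H$, let $\alpha:U\to G/G$ be the projection and $\mathcal U=\{\alpha:U\to G/G\}$. Let $U^{(n)}$ be the product of $n$ copies of $U$, with its projections $\mathrm{pr}_i$, $\mathrm{pr}_{ij}$ (the latter onto the $i$-th and $j$-th factors). For a presheaf $P$ of abelian groups, $\check H^\bullet(\mathcal U,P)$ is the cohomology of the Čech complex with $P(U^{(n+1)})$ in degree $n\ge 0$ and with $d^n$ the alternating sum of the maps induced by the $n+2$ projections $U^{(n+2)}\to U^{(n+1)}$ that omit one factor. For a finite group $K$, let $T(K)$ be the group of stable isomorphism classes of endotrivial $kK$-modules, i.e. the group of isomorphism classes of $\otimes$-invertible objects in the stable category of finite-dimensional $kK$-modules. For $K=H$, taking the fibre at the coset $[1]\in G/H$, $V\mapsto \iota_H^*V=V_{[1]}$, is a $\otimes$-functor from $\mathrm{StRep}(G/H)$ to the stable category of all $kH$-modules. **Theorem.** (a) The image of $\alpha^*:\mathrm{StPic}(G/G)\to\mathrm{StPic}(U)$ is contained in $\check H^0(\mathcal U,\mathrm{StPic})=\mathrm{Ker}\big(\mathrm{pr}_1^*-\mathrm{pr}_2^*:\mathrm{StPic}(U)\to\mathrm{StPic}(U^{(2)})\big)$.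 (b) Let $w\in\check H^0(\mathcal U,\mathrm{StPic})$. There is an object $W\in\mathrm{StRep}(U)$ whose isomorphism class is $w$, and for every such $W$ there is an isomorphism $\xi:\mathrm{pr}_2^*W\to\mathrm{pr}_1^*W$ in $\mathrm{StRep}(U^{(2)})$. For all such $W$ and $\xi$ there is a unique $\zeta=\zeta(W,\xi)\in\mathbb G_m(U^{(3)})$ such that, as automorphisms of $\mathrm{pr}_3^*W$, $$\zeta\otimes \mathrm{pr}_3^*W=\mathrm{pr}_{13}^*(\xi)^{-1}\circ\mathrm{pr}_{12}^*(\xi)\circ\mathrm{pr}_{23}^*(\xi).$$ This $\zeta$ is a 2-cocycle in the Čech complex of $\mathcal U$ with coefficients in $\mathbb G_m$, and its class in $\check H^2(\mathcal U,\mathbb G_m)$ depends only on $w$, neither on the choice of $\xi$ nor on that of $W$. (c) The construction in (b) yields a well-defined group homomorphism $$z:\check H^0(\mathcal U,\mathrm{StPic})\to\check H^2(\mathcal U,\mathbb G_m),\qquad w\mapsto[\zeta(W,\xi)].$$ (d) $\mathrm{Im}\big(\alpha^*:\mathrm{StPic}(G/G)\to\mathrm{StPic}(U)\big)=\mathrm{Ker}(z)$.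 (e) The functor $\iota_H^*$ induces an isomorphism $\mathrm{StPic}(G/H)\cong T(H)$ (the class of $V$ is sent to the class in $T(H)$ whose members are isomorphic to $V_{[1]}$ in the stable category of $kH$-modules), and it restricts to an isomorphism from $\mathrm{Ker}(z)$ onto $\mathrm{Im}\big(T(G)\to T(H)\big)$, the image of restriction. -/

import Mathlib

open CategoryTheory MonoidalCategory

universe w v u

namespace StackRep

section StableCategory

variable (A : Type*) [Category* A] [Preadditive A]

/-- Two parallel morphisms are stably equal when their difference factors through a projective
object. -/
def stableRel : HomRel A := fun X Y f g =>
  ∃ (P : A) (_ : Projective P) (a : X ⟶ P) (b : P ⟶ Y), f - g = a ≫ b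

/-- Being stably equal is a congruence, so that the morphisms of the stable category are exactly
the classes of stably equal morphisms. -/
instance stableRel_congruence [Limits.HasZeroObject A]
    [Limits.HasBinaryBiproducts A] : Congruence (stableRel A) where
  equivalence := by
    intro X Y
    refine ⟨fun f => ?_, ?_, ?_⟩
    · exact ⟨_, Projective.zero_projective, 0, 0, by simp⟩
    · rintro f g ⟨P, hP, a, b, h⟩
      exact ⟨P, hP, -a, b, by rw [← neg_sub, h, Preadditive.neg_comp]⟩
    · rintro f g h ⟨P, hP, a, b, hab⟩ ⟨Q, hQ, c, d, hcd⟩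
      refine ⟨P ⊞ Q, inferInstance, Limits.biprod.lift a c, Limits.biprod.desc b d, ?_⟩
      rw [Limits.biprod.lift_desc, ← hab, ← hcd]; abel
  comp_left := by
    rintro X Y Z f g g' ⟨P, hP, a, b, h⟩
    exact ⟨P, hP, f ≫ a, b, by rw [← Preadditive.comp_sub, h, Category.assoc]⟩
  comp_right := by
    rintro X Y Z f f' g ⟨P, hP, a, b, h⟩
    exact ⟨P, hP, a, b ≫ g, by rw [← Preadditive.sub_comp, h, Category.assoc]⟩

/-- The stable category of `A`: the additive quotient of `A` by its projective objects. -/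
abbrev Stable := CategoryTheory.Quotient (stableRel A)

/-- The projection from a category to its stable category. -/
abbrev toStable : A ⥤ Stable A := CategoryTheory.Quotient.functor (stableRel A)

variable {A}

/-- An additive functor that preserves projective objects induces a functor on stable
categories. -/
abbrev stableMap {B : Type*} [Category* B] [Preadditive B] (F : A ⥤ B) [F.Additive]
    [F.PreservesProjectiveObjects] : Stable A ⥤ Stable B :=
  CategoryTheory.Quotient.lift (stableRel A) (F ⋙ toStable B) (by
    rintro X Y f g ⟨P, hP, a, b, h⟩
    exact CategoryTheory.Quotient.sound _ ⟨F.obj P, inferInstance, F.map a, F.map b,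
      by rw [← F.map_sub, h, F.map_comp]⟩)

variable (A) in
/-- The projective objects of a monoidal category form a tensor ideal. -/
class ProjectivesTensorIdeal [MonoidalCategory A] : Prop where
  tensorLeft (X : A) : (tensorLeft X).PreservesProjectiveObjects
  tensorRight (X : A) : (tensorRight X).PreservesProjectiveObjects

attribute [instance] ProjectivesTensorIdeal.tensorLeft ProjectivesTensorIdeal.tensorRight

section Monoidal

variable [MonoidalCategory A] [MonoidalPreadditive A] [ProjectivesTensorIdeal A]

instance : MonoidalCategoryStruct (Stable A) where
  tensorObj X Y := ⟨X.as ⊗ Y.as⟩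
  whiskerLeft X _ _ f := (stableMap (tensorLeft X.as)).map f
  whiskerRight f Y := (stableMap (tensorRight Y.as)).map f
  tensorHom {_ X₂ Y₁ _} f g :=
    (stableMap (tensorRight Y₁.as)).map f ≫ (stableMap (tensorLeft X₂.as)).map g
  tensorUnit := ⟨𝟙_ A⟩
  associator X Y Z := (toStable A).mapIso (α_ X.as Y.as Z.as)
  leftUnitor X := (toStable A).mapIso (λ_ X.as)
  rightUnitor X := (toStable A).mapIso (ρ_ X.as)

/-- The tensor product of the stable category is the one induced by that of `A`. -/
instance : MonoidalCategory (Stable A) where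
  tensorHom_def _ _ := rfl
  id_tensorHom_id X Y := by
    refine congrArg (toStable A).map (?_ : 𝟙 X.as ▷ Y.as ≫ X.as ◁ 𝟙 Y.as = 𝟙 _)
    simp
  tensorHom_comp_tensorHom {X₁ Y₁ Z₁ X₂ Y₂ Z₂} f₁ f₂ g₁ g₂ := by
    obtain ⟨f₁, rfl⟩ := (toStable A).map_surjective (X := X₁.as) (Y := Y₁.as) f₁
    obtain ⟨f₂, rfl⟩ := (toStable A).map_surjective (X := X₂.as) (Y := Y₂.as) f₂
    obtain ⟨g₁, rfl⟩ := (toStable A).map_surjective (X := Y₁.as) (Y := Z₁.as) g₁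
    obtain ⟨g₂, rfl⟩ := (toStable A).map_surjective (X := Y₂.as) (Y := Z₂.as) g₂
    refine congrArg (toStable A).map (?_ : (f₁ ▷ X₂.as ≫ Y₁.as ◁ f₂) ≫ g₁ ▷ Y₂.as ≫ Z₁.as ◁ g₂ =
      (f₁ ≫ g₁) ▷ X₂.as ≫ Z₁.as ◁ (f₂ ≫ g₂))
    simp only [← MonoidalCategory.tensorHom_def, tensorHom_comp_tensorHom]
  whiskerLeft_id X Y := congrArg (toStable A).map (MonoidalCategory.whiskerLeft_id X.as Y.as)
  id_whiskerRight X Y := congrArg (toStable A).map (MonoidalCategory.id_whiskerRight X.as Y.as)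
  associator_naturality {X₁ X₂ X₃ Y₁ Y₂ Y₃} f₁ f₂ f₃ := by
    obtain ⟨f₁, rfl⟩ := (toStable A).map_surjective (X := X₁.as) (Y := Y₁.as) f₁
    obtain ⟨f₂, rfl⟩ := (toStable A).map_surjective (X := X₂.as) (Y := Y₂.as) f₂
    obtain ⟨f₃, rfl⟩ := (toStable A).map_surjective (X := X₃.as) (Y := Y₃.as) f₃
    refine congrArg (toStable A).map (?_ :
      ((f₁ ▷ X₂.as ≫ Y₁.as ◁ f₂) ▷ X₃.as ≫ (Y₁.as ⊗ Y₂.as) ◁ f₃) ≫ (α_ _ _ _).hom =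
        (α_ _ _ _).hom ≫ f₁ ▷ (X₂.as ⊗ X₃.as) ≫ Y₁.as ◁ (f₂ ▷ X₃.as ≫ Y₂.as ◁ f₃))
    simp only [← MonoidalCategory.tensorHom_def, associator_naturality]
  leftUnitor_naturality {X Y} f := by
    obtain ⟨f, rfl⟩ := (toStable A).map_surjective (X := X.as) (Y := Y.as) f
    exact congrArg (toStable A).map (MonoidalCategory.leftUnitor_naturality f)
  rightUnitor_naturality {X Y} f := by
    obtain ⟨f, rfl⟩ := (toStable A).map_surjective (X := X.as) (Y := Y.as) f
    exact congrArg (toStable A).map (MonoidalCategory.rightUnitor_naturality f)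
  pentagon W X Y Z :=
    congrArg (toStable A).map (MonoidalCategory.pentagon W.as X.as Y.as Z.as)
  triangle X Y := congrArg (toStable A).map (MonoidalCategory.triangle X.as Y.as)

instance [SymmetricCategory A] : BraidedCategory (Stable A) where
  braiding X Y := (toStable A).mapIso (β_ X.as Y.as)
  braiding_naturality_right X Y Z f := by
    obtain ⟨f, rfl⟩ := (toStable A).map_surjective (X := Y.as) (Y := Z.as) f
    exact congrArg (toStable A).map (BraidedCategory.braiding_naturality_right X.as f)
  braiding_naturality_left {X Y} f Z := by
    obtain ⟨f, rfl⟩ := (toStable A).map_surjective (X := X.as) (Y := Y.as) f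
    exact congrArg (toStable A).map (BraidedCategory.braiding_naturality_left f Z.as)
  hexagon_forward X Y Z :=
    congrArg (toStable A).map (BraidedCategory.hexagon_forward X.as Y.as Z.as)
  hexagon_reverse X Y Z :=
    congrArg (toStable A).map (BraidedCategory.hexagon_reverse X.as Y.as Z.as)

instance [SymmetricCategory A] : SymmetricCategory (Stable A) where
  symmetry X Y := congrArg (toStable A).map (SymmetricCategory.symmetry X.as Y.as)

open Functor.LaxMonoidal Functor.OplaxMonoidal

/-- The functor induced on stable categories by a tensor functor is a tensor functor. -/
instance {B : Type*} [Category* B] [Preadditive B] [MonoidalCategory B] [MonoidalPreadditive B]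
    [ProjectivesTensorIdeal B] (F : A ⥤ B) [F.Additive] [F.PreservesProjectiveObjects]
    [F.Monoidal] : (stableMap F).Monoidal :=
  Functor.CoreMonoidal.toMonoidal
    { εIso := (toStable B).mapIso (Functor.Monoidal.εIso F)
      μIso X Y := (toStable B).mapIso (Functor.Monoidal.μIso F X.as Y.as)
      μIso_hom_natural_left := by
        intro X Y f Z
        obtain ⟨f, rfl⟩ := (toStable A).map_surjective (X := X.as) (Y := Y.as) f
        exact congrArg (toStable B).map (Functor.LaxMonoidal.μ_natural_left F f Z.as)
      μIso_hom_natural_right := by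
        intro X Y Z f
        obtain ⟨f, rfl⟩ := (toStable A).map_surjective (X := X.as) (Y := Y.as) f
        exact congrArg (toStable B).map (Functor.LaxMonoidal.μ_natural_right F Z.as f)
      associativity X Y Z :=
        congrArg (toStable B).map (Functor.LaxMonoidal.associativity F X.as Y.as Z.as)
      left_unitality X :=
        congrArg (toStable B).map (Functor.LaxMonoidal.left_unitality F X.as)
      right_unitality X :=
        congrArg (toStable B).map (Functor.LaxMonoidal.right_unitality F X.as) }

end Monoidal
end StableCategory
end StackRep

namespace StackRep
section Rep
variable (k : Type u) [Field k]

/-- Representations over `k` of a groupoid `C`: functors from `C` to `k`-vector spaces. -/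
abbrev Rp (C : Type w) [Groupoid.{v} C] := C ⥤ ModuleCat.{u} k

instance (V : ModuleCat.{u} k) : (ihom V).PreservesEpimorphisms where
  preserves {Y Z} f hf := by
    have : Projective V := ModuleCat.projective_of_free (Module.Basis.ofVectorSpace k V)
    rw [ModuleCat.epi_iff_surjective]
    intro g
    exact ⟨(Projective.factorThru (show V ⟶ Z from g) f : V ⟶ Y), Projective.factorThru_comp _ f⟩

instance (C : Type w) [Groupoid.{v} C] : MonoidalPreadditive (Rp k C) where
  whiskerLeft_zero := by intros; ext : 2; simp; rfl
  zero_whiskerRight := by intros; ext : 2; simp; rfl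
  whiskerLeft_add := by intros; ext : 2; simp; rfl
  add_whiskerRight := by intros; ext : 2; simp; rfl

instance (C : Type w) [Groupoid.{v} C] : ProjectivesTensorIdeal (Rp k C) := by
  have h (X : Rp k C) : (tensorLeft X).PreservesProjectiveObjects := by
    have : (ihom X).PreservesEpimorphisms := ⟨fun {Y Z} f hf => by
      have (c : C) : Epi (((ihom X).map f).app c) := by
        have : Epi (f.app c) := inferInstance
        have := (ihom (X.obj c)).map_epi (f.app c)
        rw [Functor.ihom_map, Functor.closedIhom_map_app]
        exact this
      exact NatTrans.epi_of_epi_app _⟩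
    exact Functor.preservesProjectiveObjects_of_adjunction_of_preservesEpimorphisms
      (ihom.adjunction X)
  refine ⟨h, fun X => ⟨fun {Y} hY => ?_⟩⟩
  exact Projective.of_iso (β_ X Y) ((h X).projective_obj hY)

variable {k} in
/-- Over a groupoid with at most one morphism between any two objects, a pointwise surjective
morphism of diagrams of vector spaces is surjective on limits. -/
lemma epi_of_isLimit_of_thin {J : Type w} [Groupoid.{v} J] [Quiver.IsThin J]
    {X Y : J ⥤ ModuleCat.{u} k} (τ : X ⟶ Y) [∀ j, Epi (τ.app j)]
    {c : Limits.Cone X} {d : Limits.Cone Y} (hc : Limits.IsLimit c) (hd : Limits.IsLimit d)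
    (f : c.pt ⟶ d.pt) (hf : ∀ j, f ≫ d.π.app j = c.π.app j ≫ τ.app j) : Epi f := by
  rw [ModuleCat.epi_iff_surjective]
  intro y
  let S : Setoid J := isIsomorphicSetoid J
  let r (j : J) : J := (Quotient.mk S j).out
  let φ (j : J) : r j ≅ j := (Quotient.exact (Quotient.out_eq (Quotient.mk S j))).some
  have hr {i j : J} (m : i ⟶ j) : r i = r j :=
    congrArg Quotient.out (Quotient.sound (s := S) ⟨asIso m⟩)
  have hs (j : J) : Function.Surjective (τ.app j) :=
    (ModuleCat.epi_iff_surjective _).1 inferInstance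
  choose x hx using fun j => hs j (d.π.app j y)
  let t (j : J) : X.obj j := X.map (φ j).hom (x (r j))
  have key {i j : J} (e : i = j) {l : J} (a : i ⟶ l) (b : j ⟶ l) :
      X.map a (x i) = X.map b (x j) := by
    subst e
    rw [Subsingleton.elim a b]
  have ht {i j : J} (m : i ⟶ j) : X.map m (t i) = t j := by
    have := key (hr m) ((φ i).hom ≫ m) (φ j).hom
    rw [X.map_comp] at this
    exact this
  have hτ (j : J) : τ.app j (t j) = d.π.app j y := by
    have h1 := ConcreteCategory.congr_hom (τ.naturality (φ j).hom) (x (r j))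
    have h2 := ConcreteCategory.congr_hom (d.w (φ j).hom) y
    simp only [ConcreteCategory.comp_apply] at h1 h2
    rw [← h2, ← hx, ← h1]
  let hc' := Limits.isLimitOfPreserves (forget (ModuleCat.{u} k)) hc
  let z := (Limits.Types.isLimitEquivSections hc').symm ⟨t, fun m => ht m⟩
  have hz (j : J) : c.π.app j z = t j :=
    Limits.Types.isLimitEquivSections_symm_apply hc' ⟨t, fun m => ht m⟩ j
  refine ⟨z, ?_⟩
  refine Limits.Concrete.isLimit_ext _ hd _ _ fun j => ?_
  have h3 := ConcreteCategory.congr_hom (hf j) z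
  simp only [ConcreteCategory.comp_apply] at h3
  rw [← hτ, ← hz]
  exact h3

/-- Restriction of representations along a faithful functor of groupoids preserves projective
objects. -/
instance {C D : Type*} [Groupoid C] [Groupoid D] [EssentiallySmall.{u} C]
    [LocallySmall.{u} D] (F : C ⥤ D) [F.Faithful] :
    ((Functor.whiskeringLeft C D (ModuleCat.{u} k)).obj F).PreservesProjectiveObjects := by
  have (d : D) : Limits.HasLimitsOfShape (StructuredArrow d F) (ModuleCat.{u} k) :=
    Limits.hasLimitsOfShape_of_essentiallySmall.{u} _ _
  have : (F.ran (H := ModuleCat.{u} k)).PreservesEpimorphisms := ⟨fun {X Y} τ hτ => by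
    have (d : D) : Epi ((F.ran.map τ).app d) := by
      let gr : Groupoid (StructuredArrow d F) := Groupoid.ofIsIso fun {a b} m => by
        have : IsIso ((StructuredArrow.proj d F).map m) := inferInstance
        exact isIso_of_reflects_iso m (StructuredArrow.proj d F)
      have : Quiver.IsThin (StructuredArrow d F) := fun a b => ⟨fun m n => by
        ext
        apply F.map_injective
        have h1 := StructuredArrow.w m
        rw [← StructuredArrow.w n] at h1
        exact (cancel_epi _).1 h1⟩
      have (j : StructuredArrow d F) :
          Epi ((Functor.whiskerLeft (StructuredArrow.proj d F) τ).app j) :=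
        inferInstanceAs (Epi (τ.app j.right))
      refine epi_of_isLimit_of_thin (Functor.whiskerLeft (StructuredArrow.proj d F) τ)
        (F.isPointwiseRightKanExtensionRanCounit X d)
        (F.isPointwiseRightKanExtensionRanCounit Y d) ((F.ran.map τ).app d) fun j => ?_
      have h1 := NatTrans.congr_app (F.ranCounit.naturality τ) j.right
      have h2 := (F.ran.map τ).naturality j.hom
      dsimp at h1 h2
      have h3 : (F.ran.map τ).app d ≫ (F.ran.obj Y).map j.hom ≫ (F.ranCounit.app Y).app j.right =
          ((F.ran.obj X).map j.hom ≫ (F.ranCounit.app X).app j.right) ≫ τ.app j.right := by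
        rw [← Category.assoc, ← h2, Category.assoc, h1, Category.assoc]
      exact h3
    exact NatTrans.epi_of_epi_app _⟩
  exact Functor.preservesProjectiveObjects_of_adjunction_of_preservesEpimorphisms
    (F.ranAdjunction (ModuleCat.{u} k))
end Rep
end StackRep

namespace StackRep

/-! ### Picard groups -/

/-- The Picard group of a symmetric monoidal category: the group of isomorphism classes of
tensor-invertible objects. -/
abbrev Pic (A : Type*) [Category* A] [MonoidalCategory A] := (Skeleton A)ˣ

/-- The homomorphism of Picard groups induced by a tensor functor; it sends the class of `V` to
the class of `F V`. -/
noncomputable def Pic.map {A B : Type*} [Category* A] [Category* B] [MonoidalCategory A]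
    [MonoidalCategory B] (F : A ⥤ B) [F.Monoidal] : Pic A →* Pic B :=
  Units.map (Skeleton.monoidHom F)

lemma monoidHom_toSkeleton {A B : Type*} [Category* A] [Category* B] [MonoidalCategory A]
    [MonoidalCategory B] (F : A ⥤ B) [F.Monoidal] (V : A) :
    Skeleton.monoidHom F (toSkeleton V) = toSkeleton (F.obj V) :=
  F.mapSkeleton_obj_toSkeleton V

/-- The automorphisms of the tensor unit form a commutative group under composition. -/
instance (A : Type*) [Category* A] [MonoidalCategory A] : CommGroup (Aut (𝟙_ A)) where
  mul_comm f g := by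
    ext
    change g.hom ≫ f.hom = f.hom ≫ g.hom
    rw [← cancel_epi (λ_ (𝟙_ A)).hom, ← MonoidalCategory.leftUnitor_naturality_assoc,
      MonoidalCategory.unitors_equal, ← MonoidalCategory.rightUnitor_naturality,
      ← MonoidalCategory.rightUnitor_naturality_assoc, ← MonoidalCategory.unitors_equal,
      ← MonoidalCategory.leftUnitor_naturality, MonoidalCategory.whisker_exchange_assoc]

/-- The homomorphism on automorphism groups of tensor units induced by a tensor functor, under the
identification of `F 𝟙` with `𝟙`. -/
def unitAutMap {A B : Type*} [Category* A] [Category* B] [MonoidalCategory A]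
    [MonoidalCategory B] (F : A ⥤ B) [F.Monoidal] : Aut (𝟙_ A) →* Aut (𝟙_ B) :=
  ((Functor.Monoidal.εIso F).symm.conjAut).toMonoidHom.comp (F.mapAut (𝟙_ A))

/-- The automorphism `ζ ⊗ M` of `M ≅ 𝟙 ⊗ M` given by an automorphism `ζ` of the tensor unit. -/
def unitAct {A : Type*} [Category* A] [MonoidalCategory A] (ζ : Aut (𝟙_ A)) (M : A) : M ≅ M :=
  (λ_ M).symm ≪≫ whiskerRightIso ζ M ≪≫ λ_ M

/-! ### Stable representations of groupoids -/

section Rep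

variable (k : Type u) [Field k]

/-- The stable category of representations over `k` of a groupoid `C`. -/
abbrev StRp (C : Type w) [Groupoid.{v} C] := Stable (Rp k C)

/-- Restriction of stable representations along a faithful functor of groupoids. -/
noncomputable abbrev stRes {C D : Type*} [Groupoid C] [Groupoid D] [EssentiallySmall.{u} C]
    [LocallySmall.{u} D] (F : C ⥤ D) [F.Faithful] : StRp k D ⥤ StRp k C :=
  stableMap ((Functor.whiskeringLeft C D (ModuleCat.{u} k)).obj F)

end Rep

/-! ### Finite `G`-sets -/

/-- A finite left `G`-set. -/
structure FinGSet (G : Type v) [Group G] where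
  /-- The underlying set. -/
  carrier : Type v
  [action : MulAction G carrier]
  [finite : Finite carrier]

attribute [instance] FinGSet.action FinGSet.finite

/-- The category of finite `G`-sets and `G`-equivariant maps. -/
instance (G : Type v) [Group G] : Category (FinGSet.{v} G) where
  Hom X Y := X.carrier →[G] Y.carrier
  id X := MulActionHom.id G
  comp f g := g.comp f

section GSets

variable {G : Type v} [Group G]

/-- The `G`-equivariant map underlying a morphism of finite `G`-sets. -/
def FinGSet.toMap {X Y : FinGSet.{v} G} (α : X ⟶ Y) : X.carrier →[G] Y.carrier := α

/-- The action groupoid of `G` on `X`: its objects are the elements of `X`, and a morphism from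
`x` to `y` is an element `g` of `G` with `g • x = y`. -/
@[ext]
structure ActionGroupoid (X : FinGSet.{v} G) where
  /-- The element of `X`. -/
  pt : X.carrier

/-- Composition in the action groupoid is multiplication in `G`. -/
instance (X : FinGSet.{v} G) : Groupoid (ActionGroupoid X) where
  Hom x y := { g : G // g • x.pt = y.pt }
  id x := ⟨1, one_smul G x.pt⟩
  comp a b := ⟨b.val * a.val, by rw [mul_smul, a.property, b.property]⟩
  id_comp a := Subtype.ext (mul_one a.val)
  comp_id a := Subtype.ext (one_mul a.val)
  assoc a b c := Subtype.ext (mul_assoc c.val b.val a.val).symm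
  inv a := ⟨a.val⁻¹, inv_smul_eq_iff.2 a.property.symm⟩
  inv_comp a := Subtype.ext (mul_inv_cancel a.val)
  comp_inv a := Subtype.ext (inv_mul_cancel a.val)

instance (X : FinGSet.{v} G) : Small.{u} (ActionGroupoid X) :=
  small_of_injective (f := ActionGroupoid.pt) fun _ _ h => ActionGroupoid.ext h

instance [Finite G] (X : FinGSet.{v} G) : LocallySmall.{u} (ActionGroupoid X) :=
  ⟨fun x y => inferInstanceAs (Small.{u} { g : G // g • x.pt = y.pt })⟩

instance [Finite G] : LocallySmall.{u} (SingleObj G) :=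
  ⟨fun _ _ => inferInstanceAs (Small.{u} G)⟩

/-- The functor between action groupoids induced by a `G`-map `α`: it is `α` on objects and the
identity on the group elements that are the morphisms. -/
def actionMap {X Y : FinGSet.{v} G} (α : X ⟶ Y) : ActionGroupoid X ⥤ ActionGroupoid Y where
  obj x := ⟨FinGSet.toMap α x.pt⟩
  map g := ⟨g.val, by rw [← map_smul, g.property]⟩
  map_id _ := rfl
  map_comp _ _ := rfl

instance {X Y : FinGSet.{v} G} (α : X ⟶ Y) : (actionMap α).Faithful where
  map_injective h := Subtype.ext (congrArg Subtype.val h :)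

/-- The `G`-orbit `G/H`. -/
def orbit [Finite G] (H : Subgroup G) : FinGSet.{v} G := ⟨G ⧸ H⟩

/-- The projection `G/H → G/G`. -/
def orbitProj [Finite G] (H : Subgroup G) : orbit H ⟶ orbit (⊤ : Subgroup G) :=
  show (G ⧸ H) →[G] (G ⧸ (⊤ : Subgroup G)) from
  { toFun := Subgroup.quotientMapOfLE le_top
    map_smul' := by rintro g ⟨x⟩; rfl }

/-- The functor from the one-object groupoid of `H` to the action groupoid of `G/H`, sending the
object to the coset of `1`. -/
def orbitIncl [Finite G] (H : Subgroup G) :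
    SingleObj H ⥤ ActionGroupoid (orbit H) where
  obj _ := ⟨((1 : G) : G ⧸ H)⟩
  map h := ⟨((show H from h) : G), by
    change (((show H from h) : G) • ((1 : G) : G ⧸ H)) = ((1 : G) : G ⧸ H)
    rw [MulAction.Quotient.smul_coe, QuotientGroup.eq]
    simp⟩
  map_id _ := rfl
  map_comp _ _ := rfl

instance [Finite G] (H : Subgroup G) : (orbitIncl H).Faithful where
  map_injective h := Subtype.ext (congrArg Subtype.val h :)

end GSets

/-! ### The presheaves of stable categories, of Picard groups and of units -/

section Presheaves

variable (k : Type u) [Field k] {G : Type v} [Group G] [Finite G]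

/-- The stable category of representations over `k` of the finite `G`-set `X`. -/
abbrev StRep (X : FinGSet.{v} G) := StRp k (ActionGroupoid X)

/-- The restriction functor `α^*` along a `G`-map `α`. -/
noncomputable abbrev pull {X Y : FinGSet.{v} G} (α : Y ⟶ X) : StRep k X ⥤ StRep k Y :=
  stRes k (actionMap α)

/-- The identity `β^* α^* V = (α ∘ β)^* V`. -/
noncomputable def pullTrans {X Y Z : FinGSet.{v} G} (β : Z ⟶ Y) (α : Y ⟶ X) (γ : Z ⟶ X) (h : β ≫ α = γ)
    (V : StRep k X) : (pull k β).obj ((pull k α).obj V) ≅ (pull k γ).obj V :=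
  eqToIso (by subst h; rfl)

variable (G) in
/-- The presheaf of Picard groups of the stable categories. -/
noncomputable def stPic : (FinGSet.{v} G)ᵒᵖ ⥤ CommGrpCat.{max v (u + 1)} where
  obj X := CommGrpCat.of (Pic (StRep k X.unop))
  map α := CommGrpCat.ofHom (Pic.map (pull k α.unop))
  map_id X := by
    ext w
    obtain ⟨V, hV⟩ := Quotient.exists_rep (w : Pic (StRep k X.unop)).val
    change Skeleton.monoidHom _ (w : Pic (StRep k X.unop)).val = (w : Pic (StRep k X.unop)).val
    rw [← hV]
    exact monoidHom_toSkeleton _ V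
  map_comp {X Y Z} α β := by
    ext w
    obtain ⟨V, hV⟩ := Quotient.exists_rep (w : Pic (StRep k X.unop)).val
    change Skeleton.monoidHom _ (w : Pic (StRep k X.unop)).val =
      Skeleton.monoidHom _ (Skeleton.monoidHom _ (w : Pic (StRep k X.unop)).val)
    rw [← hV]
    change Skeleton.monoidHom _ (toSkeleton V) =
      Skeleton.monoidHom _ (Skeleton.monoidHom _ (toSkeleton V))
    rw [monoidHom_toSkeleton, monoidHom_toSkeleton, monoidHom_toSkeleton]
    rfl

/-- The object `V` represents the class `w` in the Picard group. -/
def HasClass {X : FinGSet.{v} G} (w : (stPic k G).obj (Opposite.op X)) (V : StRep k X) : Prop :=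
  (show Pic (StRep k X) from w).val = toSkeleton V

/-- Since `α^* 𝟙 = 𝟙`, the map on units induced by `α` is the restriction `α^*`. -/
lemma unitAutMap_pull {X Y : FinGSet.{v} G} (α : Y ⟶ X) (ζ : Aut (𝟙_ (StRep k X))) :
    (unitAutMap (pull k α) ζ).hom = (pull k α).map ζ.hom := by
  have h : (unitAutMap (pull k α) ζ).hom =
      𝟙 (𝟙_ (StRep k Y)) ≫ (pull k α).map ζ.hom ≫ 𝟙 (𝟙_ (StRep k Y)) := rfl
  exact h.trans ((Category.id_comp _).trans (Category.comp_id _))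

variable (G) in
/-- The presheaf of automorphism groups of the tensor units of the stable categories. -/
noncomputable def unitsGm : (FinGSet.{v} G)ᵒᵖ ⥤ CommGrpCat.{max v u} where
  obj X := CommGrpCat.of (Aut (𝟙_ (StRep k X.unop)))
  map α := CommGrpCat.ofHom (unitAutMap (pull k α.unop))
  map_id X := by
    refine CommGrpCat.hom_ext (MonoidHom.ext fun (ζ : Aut (𝟙_ (StRep k X.unop))) => ?_)
    apply Aut.ext
    refine (unitAutMap_pull k _ ζ).trans ?_
    obtain ⟨f, hf⟩ := (toStable _).map_surjective ζ.hom
    change _ = ζ.hom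
    rw [← hf]
    rfl
  map_comp {X Y Z} α β := by
    refine CommGrpCat.hom_ext (MonoidHom.ext fun (ζ : Aut (𝟙_ (StRep k X.unop))) => ?_)
    apply Aut.ext
    refine (unitAutMap_pull k _ ζ).trans ?_
    change _ = (unitAutMap (pull k β.unop) (unitAutMap (pull k α.unop) ζ)).hom
    rw [unitAutMap_pull, unitAutMap_pull]
    obtain ⟨f, hf⟩ := (toStable _).map_surjective ζ.hom
    rw [← hf]
    rfl

end Presheaves

/-! ### Čech cohomology -/

section Cech

variable {G : Type v} [Group G] {U X : FinGSet.{v} G}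

/-- The fibre power `U ×_X ⋯ ×_X U` with `n + 1` factors. -/
def fiberPower (α : U ⟶ X) (n : ℕ) : FinGSet.{v} G :=
  let A : MulAction G
      { u : Fin (n + 1) → U.carrier // ∀ i j, FinGSet.toMap α (u i) = FinGSet.toMap α (u j) } :=
    { smul g u := ⟨fun i => g • u.val i, fun i j => by
        rw [map_smul, map_smul, u.property i j]⟩
      one_smul u := Subtype.ext (one_smul G u.val)
      mul_smul g h u := Subtype.ext (mul_smul g h u.val) }
  ⟨{ u : Fin (n + 1) → U.carrier // ∀ i j, FinGSet.toMap α (u i) = FinGSet.toMap α (u j) }⟩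

/-- The projection between fibre powers that selects the factors `s 0, s 1, …`. -/
def fiberProj (α : U ⟶ X) {m n : ℕ} (s : Fin (m + 1) → Fin (n + 1)) :
    fiberPower α n ⟶ fiberPower α m :=
  show (fiberPower α n).carrier →[G] (fiberPower α m).carrier from
  { toFun u := ⟨u.val ∘ s, fun i j => u.property (s i) (s j)⟩
    map_smul' _ _ := rfl }

/-- The projection of a fibre power onto its factor `i`, counted from `0`. -/
def factor (α : U ⟶ X) {n : ℕ} (i : Fin (n + 1)) : fiberPower α n ⟶ U :=
  show (fiberPower α n).carrier →[G] U.carrier from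
  { toFun u := u.val i
    map_smul' _ _ := rfl }

variable (P : (FinGSet.{v} G)ᵒᵖ ⥤ CommGrpCat.{w}) (α : U ⟶ X)

/-- The Čech cochains `P(U ×_X ⋯ ×_X U)`, with `n + 1` factors, of degree `n`. -/
abbrev CechCochain (n : ℕ) := P.obj (Opposite.op (fiberPower α n))

/-- The Čech differential from degree `n` to degree `n + 1`: the alternating product of the maps
induced by the `n + 2` projections that omit one factor. -/
def cechD (n : ℕ) : CechCochain P α n →* CechCochain P α (n + 1) :=
  ∏ i : Fin (n + 2), (P.map (fiberProj α i.succAbove).op).hom ^ ((-1 : ℤ) ^ (i : ℕ))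

/-- Čech cohomology in degree zero: the subgroup of `P(U)` on which the maps induced by the two
projections `U ×_X U → U` agree. -/
def cechH0 : Subgroup (P.obj (Opposite.op U)) :=
  ((P.map (factor α (0 : Fin 2)).op).hom / (P.map (factor α (1 : Fin 2)).op).hom).ker

/-- Čech cohomology in degree `n + 1`: cocycles modulo coboundaries. -/
abbrev CechH (n : ℕ) :=
  (cechD P α (n + 1)).ker ⧸ (cechD P α n).range.subgroupOf (cechD P α (n + 1)).ker

end Cech

/-! ### The obstruction to gluing -/

section Obstruction

variable (k : Type u) [Field k] {G : Type v} [Group G] [Finite G] {U X : FinGSet.{v} G}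
  (α : U ⟶ X)

/-- Isomorphisms `pr_2^* W ≅ pr_1^* W` over `U ×_X U`. -/
abbrev Gluing (W : StRep k U) :=
  (pull k (factor α (1 : Fin 2))).obj W ≅ (pull k (factor α (0 : Fin 2))).obj W

variable {k α}

/-- The isomorphism `pr_j^* W ≅ pr_i^* W` over a triple fibre power obtained by pulling back a
gluing along the projection `pr_{ij}` on the factors `i` and `j`. -/
noncomputable def Gluing.pullTo {W : StRep k U} (ξ : Gluing k α W) (i j : Fin 3) :
    (pull k (factor α j)).obj W ≅ (pull k (factor α i)).obj W :=
  (pullTrans k (fiberProj α ![i, j]) (factor α 1) (factor α j) rfl W).symm ≪≫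
    (pull k (fiberProj α ![i, j])).mapIso ξ ≪≫
    pullTrans k (fiberProj α ![i, j]) (factor α 0) (factor α i) rfl W

/-- The automorphism `pr_{13}^*(ξ)⁻¹ ∘ pr_{12}^*(ξ) ∘ pr_{23}^*(ξ)` of `pr_3^* W`. -/
noncomputable def Gluing.defect {W : StRep k U} (ξ : Gluing k α W) :
    (pull k (factor α (2 : Fin 3))).obj W ≅ (pull k (factor α (2 : Fin 3))).obj W :=
  ξ.pullTo 1 2 ≪≫ ξ.pullTo 0 1 ≪≫ (ξ.pullTo 0 2).symm

/-- `ζ` is the unit with `ζ ⊗ pr_3^* W = pr_{13}^*(ξ)⁻¹ ∘ pr_{12}^*(ξ) ∘ pr_{23}^*(ξ)`. -/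
def IsDefect {W : StRep k U} (ξ : Gluing k α W) (ζ : CechCochain (unitsGm k G) α 2) : Prop :=
  unitAct (show Aut (𝟙_ (StRep k (fiberPower α 2))) from ζ)
    ((pull k (factor α (2 : Fin 3))).obj W) = ξ.defect

end Obstruction

/-! ### The obstruction homomorphism for `G/H → G/G` -/

section ObstructionHom

variable (k : Type u) [Field k] {G : Type v} [Group G] [Finite G] (H : Subgroup G)

/-- The group `Ȟ⁰` of the cover `G/H → G/G` with coefficients in the Picard presheaf. -/
noncomputable abbrev PicH0 : Subgroup ((stPic k G).obj (Opposite.op (orbit H))) :=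
  cechH0 (stPic k G) (orbitProj H)

/-- The group `Ȟ²` of the cover `G/H → G/G` with coefficients in the units. -/
noncomputable abbrev UnitsH2 := CechH (unitsGm k G) (orbitProj H) 1

variable {k H}

/-- The homomorphism `z` sends the class of `W` to the class of the cocycle `ζ(W, ξ)`, for every
choice of the representative `W` and of the gluing `ξ`. -/
def IsObstructionHom (z : PicH0 k H →* UnitsH2 k H) : Prop :=
  ∀ (w : PicH0 k H) (W : StRep k (orbit H)), HasClass k w.val W →
    ∀ (ξ : Gluing k (orbitProj H) W) (ζ : CechCochain (unitsGm k G) (orbitProj H) 2),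
      IsDefect ξ ζ → ∃ hζ : ζ ∈ (cechD (unitsGm k G) (orbitProj H) 2).ker,
        z w = QuotientGroup.mk ⟨ζ, hζ⟩

end ObstructionHom

/-! ### Endotrivial modules -/

section Endotrivial

variable (k : Type u) [Field k] (K : Type v) [Group K] [Finite K]

/-- The representations of the group `K` with finite-dimensional underlying space, in the stable
category of all representations. -/
def finDim : ObjectProperty (StRp k (SingleObj K)) :=
  fun V => Module.Finite k (V.as.obj (SingleObj.star K))

instance : (finDim k K).IsMonoidal where
  prop_unit := inferInstanceAs (Module.Finite k k)
  prop_tensor V W hV hW := by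
    have : Module.Finite k (V.as.obj (SingleObj.star K)) := hV
    have : Module.Finite k (W.as.obj (SingleObj.star K)) := hW
    exact inferInstanceAs (Module.Finite k
      (TensorProduct k (V.as.obj (SingleObj.star K)) (W.as.obj (SingleObj.star K))))

/-- The stable category of finite-dimensional representations of `K`. -/
abbrev FinStab := (finDim k K).FullSubcategory

/-- The group `T(K)` of stable isomorphism classes of endotrivial modules: the Picard group of the
stable category of finite-dimensional representations of `K`. -/
abbrev EndoT := Pic (FinStab k K)

/-- The homomorphism from `T(K)` to the Picard group of the stable category of all
representations. -/
noncomputable def EndoT.incl : EndoT k K →* Pic (StRp k (SingleObj K)) :=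
  Pic.map (finDim k K).ι

variable {K} (H : Subgroup K)

/-- The inclusion of the one-object groupoid of a subgroup. -/
def subIncl : SingleObj H ⥤ SingleObj K := H.subtype.toFunctor

instance : (subIncl H).Faithful where
  map_injective h := Subtype.ext h

/-- Restriction of finite-dimensional stable representations from `K` to `H`. -/
noncomputable def finRes : FinStab k K ⥤ FinStab k H :=
  (finDim k H).lift ((finDim k K).ι ⋙ stRes k (subIncl H)) fun V => V.property

noncomputable instance : (finRes k H).Monoidal :=
  Functor.CoreMonoidal.toMonoidal
    { εIso := (finDim k H).isoMk (Functor.Monoidal.εIso (stRes k (subIncl H)))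
      μIso V W := (finDim k H).isoMk
        (Functor.Monoidal.μIso (stRes k (subIncl H)) V.obj W.obj)
      μIso_hom_natural_left f W := ObjectProperty.hom_ext _
        (Functor.LaxMonoidal.μ_natural_left (stRes k (subIncl H)) f.hom W.obj)
      μIso_hom_natural_right V f := ObjectProperty.hom_ext _
        (Functor.LaxMonoidal.μ_natural_right (stRes k (subIncl H)) V.obj f.hom)
      associativity V W Z := ObjectProperty.hom_ext _
        (Functor.LaxMonoidal.associativity (stRes k (subIncl H)) V.obj W.obj Z.obj)
      left_unitality V := ObjectProperty.hom_ext _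
        (Functor.LaxMonoidal.left_unitality (stRes k (subIncl H)) V.obj)
      right_unitality V := ObjectProperty.hom_ext _
        (Functor.LaxMonoidal.right_unitality (stRes k (subIncl H)) V.obj) }

/-- The restriction homomorphism `T(K) → T(H)`. -/
noncomputable def EndoT.res : EndoT k K →* EndoT k H := Pic.map (finRes k H)

/-- The homomorphism from the Picard group of the stable category of `K/H` to that of the stable
category of representations of `H`, induced by `V ↦ V_{[1]}`. -/
noncomputable def orbitPic :
    (stPic k K).obj (Opposite.op (orbit H)) →* Pic (StRp k (SingleObj H)) :=
  Pic.map (stRes k (orbitIncl H))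

end Endotrivial
end StackRep

open StackRep

/-! Tensoring with an invertible object `M` is an equivalence, so each automorphism of `M` is `ζ ⊗
M` for exactly one unit `ζ`, and these automorphisms commute with all morphisms
(`unitAct_bijective`, `unitAct_naturality`). Hence the failure of a gluing `ξ` to satisfy the
cocycle condition is a unit. Computing one composite over the fourfold fibre power in two ways shows
that this unit is a 2-cocycle (`IsDefect.mem_ker`). Changing `W` or `ξ` multiplies it by a
coboundary (`exists_coboundary`), and tensoring gluings multiplies defects (`IsDefect.tensor`). This
yields `z`; the index of `H` plays no role so far.

A restricted object `α^* V` has a tautological gluing with defect 1, so restrictions lie in the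
kernel of `z`. Conversely, if `z w = 1`, then `ξ` can be rescaled to a descent datum, and the point
is that descent is effective for stable categories. Restriction `α^*` has the sum over fibres `α_*`
as adjoint on both sides, and both functors preserve projectives, so the adjunctions pass to stable
categories. The fibres have `[G : H]` elements, which is invertible in `k`, so the trace divided by
this number is a natural retraction of the unit `1 → α_* α^*`. A descent datum becomes a coaction `W
→ α^* α_* W`; averaging it gives an idempotent of `α_* W`, and any splitting `V` satisfies `α^* V ≅
W` (`nonempty_iso_of_coaction`, `exists_descent`).

Two finiteness facts complete the argument. Stable idempotents on finite-dimensional representations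
split, because Fitting's lemma replaces them by honest idempotents (`FinVal.exists_split`).
Invertible objects are stably finite-dimensional, because a map `1 → V ⊗ V'` involves only finitely
many vectors of `V` (`exists_finVal_of_tensorInvertible`). The descended `V` is then
finite-dimensional, so it has a dual; its evaluation becomes an isomorphism after `α^*`, which
reflects isomorphisms, so `V` is invertible.

The second fact also identifies `T(H)` with the Picard group of all stable `kH`-modules, and the
action groupoid of `G/H` is equivalent to `H`; this gives (e). -/

namespace StackRep

/-! ### Invertible objects and the action of units on them -/

section Invertible

variable {A : Type*} [Category* A] [MonoidalCategory A]

/-- An object with a two-sided tensor inverse. -/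
def TensorInvertible (M : A) : Prop := ∃ N : A, Nonempty (M ⊗ N ≅ 𝟙_ A) ∧ Nonempty (N ⊗ M ≅ 𝟙_ A)

lemma isUnit_toSkeleton_iff {M : A} : IsUnit (toSkeleton M) ↔ TensorInvertible M := by
  constructor
  · rintro ⟨w, hw⟩
    obtain ⟨N, hN⟩ := Quotient.exists_rep w.inv
    have hN : toSkeleton N = w.inv := hN
    refine ⟨N, ?_, ?_⟩
    · rw [← toSkeleton_eq_toSkeleton_iff, Skeleton.toSkeleton_tensorObj, hN, ← hw]
      exact w.mul_inv
    · rw [← toSkeleton_eq_toSkeleton_iff, Skeleton.toSkeleton_tensorObj, hN, ← hw]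
      exact w.inv_mul
  · rintro ⟨N, ⟨e⟩, ⟨f⟩⟩
    refine ⟨⟨toSkeleton M, toSkeleton N, ?_, ?_⟩, rfl⟩
    · rw [← Skeleton.toSkeleton_tensorObj]
      exact congr_toSkeleton_of_iso e
    · rw [← Skeleton.toSkeleton_tensorObj]
      exact congr_toSkeleton_of_iso f

lemma TensorInvertible.of_iso {M N : A} (e : M ≅ N) (h : TensorInvertible M) :
    TensorInvertible N := by
  rw [← isUnit_toSkeleton_iff] at h ⊢
  rwa [← congr_toSkeleton_of_iso e]

lemma TensorInvertible.map {B : Type*} [Category* B] [MonoidalCategory B] (F : A ⥤ B) [F.Monoidal]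
    {M : A} (h : TensorInvertible M) : TensorInvertible (F.obj M) := by
  rw [← isUnit_toSkeleton_iff] at h ⊢
  rw [← monoidHom_toSkeleton]
  exact h.map _

/-- Tensoring with the inverse is a quasi-inverse. The two isomorphisms need not satisfy a triangle
identity: `CategoryTheory.Equivalence.mk` corrects one of them. -/
lemma TensorInvertible.isEquivalence_tensorRight {M : A} (h : TensorInvertible M) :
    (tensorRight M).IsEquivalence := by
  obtain ⟨N, ⟨e⟩, ⟨f⟩⟩ := h
  let a (X Y : A) (g : X ⊗ Y ≅ 𝟙_ A) : 𝟭 A ≅ tensorRight X ⋙ tensorRight Y :=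
    NatIso.ofComponents (fun Z => (ρ_ Z).symm ≪≫ whiskerLeftIso Z g.symm ≪≫ (α_ Z X Y).symm)
      (by
        intro Z Z' φ
        simp only [Functor.id_obj, Functor.comp_obj, Functor.id_map, Functor.comp_map,
          Iso.trans_hom, Iso.symm_hom, whiskerLeftIso_hom, Category.assoc]
        rw [rightUnitor_inv_naturality_assoc, ← whisker_exchange_assoc,
          associator_inv_naturality_left]
        rfl)
  exact (CategoryTheory.Equivalence.mk (tensorRight M) (tensorRight N) (a M N e)
    (a N M f).symm).isEquivalence_functor

lemma TensorInvertible.isEquivalence_tensorLeft {M : A} (h : TensorInvertible M) :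
    (tensorLeft M).IsEquivalence := by
  obtain ⟨N, ⟨e⟩, ⟨f⟩⟩ := h
  let a (X Y : A) (g : Y ⊗ X ≅ 𝟙_ A) : 𝟭 A ≅ tensorLeft X ⋙ tensorLeft Y :=
    NatIso.ofComponents (fun Z => (λ_ Z).symm ≪≫ whiskerRightIso g.symm Z ≪≫ (α_ Y X Z))
      (by
        intro Z Z' φ
        simp only [Functor.id_obj, Functor.comp_obj, Functor.id_map, Functor.comp_map,
          Iso.trans_hom, Iso.symm_hom, whiskerRightIso_hom, Category.assoc]
        rw [leftUnitor_inv_naturality_assoc, whisker_exchange_assoc,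
          associator_naturality_right]
        rfl)
  exact (CategoryTheory.Equivalence.mk (tensorLeft M) (tensorLeft N) (a M N f)
    (a N M e).symm).isEquivalence_functor

/-- The right adjoint `X ⊗ -` of `Y ⊗ -` is an equivalence, so the counit is invertible; at the
tensor unit it is the evaluation up to a unitor. -/
lemma isIso_evaluation_of_tensorInvertible {X Y : A} [ExactPairing X Y] (h : TensorInvertible X) :
    IsIso (ε_ X Y) := by
  have := h.isEquivalence_tensorLeft
  have h1 : IsIso ((tensorLeftAdjunction X Y).counit.app (𝟙_ A)) := inferInstance
  have h2 : (tensorLeftAdjunction X Y).counit.app (𝟙_ A) = (Y ◁ (ρ_ X).hom) ≫ ε_ X Y := by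
    simp [tensorLeftAdjunction, tensorLeftHomEquiv, unitors_equal]
  rw [h2] at h1
  exact IsIso.of_isIso_comp_left (Y ◁ (ρ_ X).hom) _

open Functor.LaxMonoidal Functor.OplaxMonoidal in
/-- The image of an exact pairing under a tensor functor. -/
@[reducible]
def exactPairingMap {B : Type*} [Category* B] [MonoidalCategory B] (F : A ⥤ B) [F.Monoidal]
    (X Y : A) [ExactPairing X Y] : ExactPairing (F.obj X) (F.obj Y) where
  coevaluation' := ε F ≫ F.map (η_ X Y) ≫ δ F X Y
  evaluation' := μ F Y X ≫ F.map (ε_ X Y) ≫ η F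
  coevaluation_evaluation' := by
    have h1 : F.obj Y ◁ F.map (η_ X Y) = μ F _ _ ≫ F.map (Y ◁ η_ X Y) ≫ δ F _ _ := by
      simp only [Functor.Monoidal.map_whiskerLeft, Category.assoc,
        Functor.Monoidal.μ_δ, Category.comp_id, Functor.Monoidal.μ_δ_assoc]
    have h2 : F.map (ε_ X Y) ▷ F.obj Y = μ F _ _ ≫ F.map (ε_ X Y ▷ Y) ≫ δ F _ _ := by
      simp only [Functor.Monoidal.map_whiskerRight, Category.assoc,
        Functor.Monoidal.μ_δ, Category.comp_id, Functor.Monoidal.μ_δ_assoc]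
    have h3 : δ F Y (X ⊗ Y) ≫ F.obj Y ◁ δ F X Y ≫ (α_ _ _ _).inv ≫ μ F Y X ▷ F.obj Y ≫ μ F _ _ =
        F.map (α_ Y X Y).inv := by simp
    simp only [MonoidalCategory.whiskerLeft_comp, comp_whiskerRight, Category.assoc, h1, h2]
    rw [reassoc_of% h3, ← F.map_comp_assoc, ← F.map_comp_assoc, Category.assoc,
      ExactPairing.coevaluation_evaluation]
    simp
  evaluation_coevaluation' := by
    have h1 : F.map (η_ X Y) ▷ F.obj X = μ F _ _ ≫ F.map (η_ X Y ▷ X) ≫ δ F _ _ := by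
      simp only [Functor.Monoidal.map_whiskerRight, Category.assoc,
        Functor.Monoidal.μ_δ, Category.comp_id, Functor.Monoidal.μ_δ_assoc]
    have h2 : F.obj X ◁ F.map (ε_ X Y) = μ F _ _ ≫ F.map (X ◁ ε_ X Y) ≫ δ F _ _ := by
      simp only [Functor.Monoidal.map_whiskerLeft, Category.assoc,
        Functor.Monoidal.μ_δ, Category.comp_id, Functor.Monoidal.μ_δ_assoc]
    have h3 : δ F (X ⊗ Y) X ≫ δ F X Y ▷ F.obj X ≫ (α_ _ _ _).hom ≫ F.obj X ◁ μ F Y X ≫ μ F _ _ =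
        F.map (α_ X Y X).hom := by simp
    simp only [MonoidalCategory.whiskerLeft_comp, comp_whiskerRight, Category.assoc, h1, h2]
    rw [reassoc_of% h3, ← F.map_comp_assoc, ← F.map_comp_assoc, Category.assoc,
      ExactPairing.evaluation_coevaluation]
    simp

section UnitAct

lemma unitAct_hom (ζ : Aut (𝟙_ A)) (M : A) :
    (unitAct ζ M).hom = (λ_ M).inv ≫ ζ.hom ▷ M ≫ (λ_ M).hom := rfl

/-- In `𝟙 ⊗ M` the unit acts on the left factor and `f` on the right one, so they commute. This
centrality lets units move past gluings. -/
lemma unitAct_naturality (ζ : Aut (𝟙_ A)) {M N : A} (f : M ⟶ N) :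
    (unitAct ζ M).hom ≫ f = f ≫ (unitAct ζ N).hom := by
  simp only [unitAct_hom, Category.assoc, ← leftUnitor_naturality, leftUnitor_inv_naturality_assoc,
    whisker_exchange_assoc]

lemma unitAct_naturality_assoc (ζ : Aut (𝟙_ A)) {M N : A} (f : M ⟶ N) {N' : A} (h : N ⟶ N') :
    (unitAct ζ M).hom ≫ f ≫ h = f ≫ (unitAct ζ N).hom ≫ h := by
  rw [← Category.assoc, unitAct_naturality, Category.assoc]

lemma unitAct_mul (ζ η : Aut (𝟙_ A)) (M : A) :
    (unitAct (ζ * η) M).hom = (unitAct η M).hom ≫ (unitAct ζ M).hom := by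
  have : (ζ * η).hom = η.hom ≫ ζ.hom := rfl
  simp [unitAct_hom, this]

lemma unitAct_one (M : A) : (unitAct (1 : Aut (𝟙_ A)) M).hom = 𝟙 M := by
  have : (1 : Aut (𝟙_ A)).hom = 𝟙 _ := rfl
  simp [unitAct_hom, this]

/-- Up to the left unitor this is the effect of the fully faithful functor `- ⊗ M` on automorphisms
of `𝟙`. -/
lemma unitAct_bijective {M : A} (h : TensorInvertible M) :
    Function.Bijective (fun ζ : Aut (𝟙_ A) => unitAct ζ M) := by
  have := h.isEquivalence_tensorRight
  constructor
  · intro ζ η he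
    have h1 := congrArg Iso.hom he
    simp only [unitAct_hom, cancel_epi] at h1
    have h2 : ζ.hom ▷ M = η.hom ▷ M := (cancel_mono (λ_ M).hom).1 h1
    exact Aut.ext ((tensorRight M).map_injective h2)
  · intro f
    let ζ : 𝟙_ A ≅ 𝟙_ A := (tensorRight M).preimageIso (λ_ M ≪≫ f ≪≫ (λ_ M).symm)
    have : ζ.hom ▷ M = (λ_ M ≪≫ f ≪≫ (λ_ M).symm).hom := (tensorRight M).map_preimage _
    refine ⟨ζ, ?_⟩
    ext
    refine (unitAct_hom _ _).trans ?_
    rw [this]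
    simp

lemma unitAct_tensor_left (ζ : Aut (𝟙_ A)) (M N : A) :
    (unitAct ζ (M ⊗ N)).hom = (unitAct ζ M).hom ▷ N := by
  simp [unitAct_hom]

/-- The braiding carries the unit to the second factor. Together with `unitAct_tensor_left` this
makes defects multiplicative. -/
lemma unitAct_tensor_right [BraidedCategory A] (ζ : Aut (𝟙_ A)) (M N : A) :
    (unitAct ζ (M ⊗ N)).hom = M ◁ (unitAct ζ N).hom := by
  rw [← cancel_mono (β_ M N).hom, unitAct_naturality, unitAct_tensor_left]
  simp

open Functor.LaxMonoidal Functor.OplaxMonoidal in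
lemma map_unitAct {B : Type*} [Category* B] [MonoidalCategory B] (F : A ⥤ B) [F.Monoidal]
    (ζ : Aut (𝟙_ A)) (M : A) :
    F.map (unitAct ζ M).hom = (unitAct (unitAutMap F ζ) (F.obj M)).hom := by
  have : (unitAutMap F ζ).hom = ε F ≫ F.map ζ.hom ≫ η F := rfl
  rw [unitAct_hom, unitAct_hom, this]
  simp

end UnitAct
end Invertible

/-! ### Picard groups through representatives -/

section PicMap

variable {A B : Type*} [Category* A] [Category* B] [MonoidalCategory A] [MonoidalCategory B]

lemma Pic.exists_rep (w : Pic A) : ∃ V : A, w.val = toSkeleton V := by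
  obtain ⟨V, hV⟩ := Quotient.exists_rep w.val
  exact ⟨V, hV.symm⟩

lemma Pic.map_val (F : A ⥤ B) [F.Monoidal] (w : Pic A) {V : A} (h : w.val = toSkeleton V) :
    (Pic.map F w).val = toSkeleton (F.obj V) := by
  rw [← monoidHom_toSkeleton, ← h]
  rfl

lemma Pic.tensorInvertible {w : Pic A} {V : A} (h : w.val = toSkeleton V) : TensorInvertible V :=
  isUnit_toSkeleton_iff.1 ⟨w, h⟩

lemma Pic.map_bijective_of_inverse (F : A ⥤ B) [F.Monoidal] (E : B ⥤ A) [E.Monoidal]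
    (h : ∀ V, Nonempty (E.obj (F.obj V) ≅ V)) (h' : ∀ V, Nonempty (F.obj (E.obj V) ≅ V)) :
    Function.Bijective (Pic.map F) := by
  refine Function.bijective_iff_has_inverse.2 ⟨Pic.map E, fun w => ?_, fun w => ?_⟩
  · obtain ⟨V, hV⟩ := Pic.exists_rep w
    ext
    rw [Pic.map_val E _ (Pic.map_val F w hV), hV]
    exact toSkeleton_eq_toSkeleton_iff.2 (h V)
  · obtain ⟨V, hV⟩ := Pic.exists_rep w
    ext
    rw [Pic.map_val F _ (Pic.map_val E w hV), hV]
    exact toSkeleton_eq_toSkeleton_iff.2 (h' V)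

end PicMap
end StackRep

namespace StackRep
-- Pushforward along a map of finite `G`-sets, adjoint to restriction on both sides
section Pushforward

variable (k : Type u) [Field k] {G : Type v} [Group G]

/-- The morphism of an action groupoid given by a group element. -/
def agHom {X : FinGSet.{v} G} {x y : ActionGroupoid X} (g : G) (h : g • x.pt = y.pt) : x ⟶ y :=
  ⟨g, h⟩

lemma agHom_comp {X : FinGSet.{v} G} {x y z : ActionGroupoid X} (g g' : G)
    (h : g • x.pt = y.pt) (h' : g' • y.pt = z.pt) :
    agHom g h ≫ agHom g' h' = agHom (g' * g) (by rw [mul_smul, h, h']) := rfl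

lemma agHom_self {X : FinGSet.{v} G} {x : ActionGroupoid X} {g : G} (h : g • x.pt = x.pt)
    (hg : g = 1) : agHom g h = 𝟙 x := Subtype.ext hg

variable {k}

/-- Restriction of representations along a map of `G`-sets. -/
abbrev res (k : Type u) [Field k] {X Y : FinGSet.{v} G} (p : Y ⟶ X) :
    Rp k (ActionGroupoid X) ⥤ Rp k (ActionGroupoid Y) :=
  (Functor.whiskeringLeft _ _ (ModuleCat.{u} k)).obj (actionMap p)

variable {X Y : FinGSet.{v} G} (p : Y ⟶ X)

/-- The fibre of a map of `G`-sets. -/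
abbrev Fib (x : X.carrier) : Type v := { y : Y.carrier // FinGSet.toMap p y = x }

variable {p} in
/-- The translate of an element of a fibre. -/
def Fib.back {x x' : X.carrier} (g : G) (h : g • x = x') (y : Fib p x') : Fib p x :=
  ⟨g⁻¹ • y.val, by rw [map_smul, y.property, ← h, inv_smul_smul]⟩

variable {p} in
lemma Fib.smul_back {x x' : X.carrier} (g : G) (h : g • x = x') (y : Fib p x') :
    g • (y.back g h).val = y.val := smul_inv_smul _ _

/-- The sum of a representation over a fibre. -/
noncomputable abbrev fibSum (W : Rp k (ActionGroupoid Y)) (x : X.carrier) : ModuleCat.{u} k :=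
  ⨁ fun y : Fib p x => W.obj ⟨y.val⟩

variable {p}

/-- The projection of a sum over a fibre onto one summand, followed by transport. -/
noncomputable abbrev fibπ (W : Rp k (ActionGroupoid Y)) {x : X.carrier} (y : Fib p x) :
    fibSum p W x ⟶ W.obj ⟨y.val⟩ :=
  Limits.biproduct.π (fun y : Fib p x => W.obj ⟨y.val⟩) y

/-- The inclusion of one summand in a sum over a fibre. -/
noncomputable abbrev fibι (W : Rp k (ActionGroupoid Y)) {x : X.carrier} (y : Fib p x) :
    W.obj ⟨y.val⟩ ⟶ fibSum p W x :=
  Limits.biproduct.ι (fun y : Fib p x => W.obj ⟨y.val⟩) y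

lemma fibπ_map_congr (W : Rp k (ActionGroupoid Y)) {x : X.carrier} {y y' : Fib p x} (h : y = y')
    {z : ActionGroupoid Y} {g g' : G} (hg : g = g') (a : g • y.val = z.pt)
    (b : g' • y'.val = z.pt) :
    fibπ W y ≫ W.map (agHom (x := ⟨y.val⟩) g a) =
      fibπ W y' ≫ W.map (agHom (x := ⟨y'.val⟩) g' b) := by
  subst h hg; rfl

lemma fibπ_map_one (W : Rp k (ActionGroupoid Y)) {x : X.carrier} {y y' : Fib p x} (h : y = y')
    {g : G} (hg : g = 1) (a : g • y.val = y'.val) :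
    fibπ W y ≫ W.map (agHom (x := ⟨y.val⟩) (y := ⟨y'.val⟩) g a) = fibπ W y' := by
  subst h
  rw [agHom_self (x := ⟨y.val⟩) _ hg, W.map_id, Category.comp_id]

/-- The action of group elements on sums over fibres. -/
noncomputable def fibSumMap (W : Rp k (ActionGroupoid Y)) {x x' : ActionGroupoid X} (a : x ⟶ x') :
    fibSum p W x.pt ⟶ fibSum p W x'.pt :=
  Limits.biproduct.lift fun y => fibπ W (y.back a.val a.property) ≫
    W.map (agHom (x := ⟨(y.back a.val a.property).val⟩) a.val (y.smul_back a.val a.property))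

lemma fibSumMap_π (W : Rp k (ActionGroupoid Y)) {x x' : ActionGroupoid X} (a : x ⟶ x')
    (y : Fib p x'.pt) :
    fibSumMap W a ≫ fibπ W y = fibπ W (y.back a.val a.property) ≫
      W.map (agHom (x := ⟨(y.back a.val a.property).val⟩) a.val (y.smul_back a.val a.property)) :=
  Limits.biproduct.lift_π _ _

lemma fibSum_hom_ext (W : Rp k (ActionGroupoid Y)) {x : X.carrier} {Z : ModuleCat.{u} k}
    {f g : Z ⟶ fibSum p W x} (h : ∀ y, f ≫ fibπ W y = g ≫ fibπ W y) : f = g :=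
  Limits.biproduct.hom_ext _ _ h

/-- The action permutes the summands, so only the component at `y'` survives. This description by
inclusions serves the adjunction with pushforward on the left, as the one by projections serves the
other. -/
lemma fibι_fibSumMap (W : Rp k (ActionGroupoid Y)) {x x' : ActionGroupoid X} (a : x ⟶ x')
    (y : Fib p x.pt) (y' : Fib p x'.pt) (h : a.val • y.val = y'.val) :
    fibι W y ≫ fibSumMap W a =
      W.map (agHom (x := ⟨y.val⟩) (y := ⟨y'.val⟩) a.val h) ≫ fibι W y' := by
  have hy : y'.back a.val a.property = y := Subtype.ext (inv_smul_eq_iff.2 h.symm)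
  refine fibSum_hom_ext W fun z => ?_
  rw [Category.assoc, fibSumMap_π, Category.assoc]
  by_cases hz : y' = z
  · subst hz
    rw [fibπ_map_congr W hy rfl _ h]
    simp
  · rw [Limits.biproduct.ι_π_ne_assoc, Limits.biproduct.ι_π_ne _ hz]
    · simp
    · rintro rfl
      exact hz (Subtype.ext (h.symm.trans (z.smul_back _ _)))

variable (p)

/-- The pushforward of representations along a map of finite `G`-sets: the sum over the fibres. -/
noncomputable def push : Rp k (ActionGroupoid Y) ⥤ Rp k (ActionGroupoid X) where
  obj W :=
    { obj x := fibSum p W x.pt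
      map a := fibSumMap W a
      map_id x := fibSum_hom_ext W fun y => by
        rw [fibSumMap_π, Category.id_comp]
        exact fibπ_map_one W (Subtype.ext (by simp [Fib.back, show (𝟙 x : x ⟶ x).val = 1 from rfl]))
          rfl _
      map_comp a b := fibSum_hom_ext W fun y => by
        rw [fibSumMap_π, Category.assoc, fibSumMap_π, ← Category.assoc, fibSumMap_π, Category.assoc,
          ← W.map_comp, agHom_comp]
        exact fibπ_map_congr W (Subtype.ext (by
          simp [Fib.back, show (a ≫ b).val = b.val * a.val from rfl, mul_smul])) rfl _ _ }
  map f :=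
    { app x := Limits.biproduct.map fun y => f.app ⟨y.val⟩
      naturality x x' a := by
        refine fibSum_hom_ext _ fun y => ?_
        rw [Category.assoc, Category.assoc, fibSumMap_π, Limits.biproduct.map_π, ← Category.assoc,
          fibSumMap_π, Limits.biproduct.map_π_assoc, Category.assoc, f.naturality] }
  map_id W := by
    ext x : 2
    exact fibSum_hom_ext _ fun y => by simp
  map_comp f g := by
    ext x : 2
    exact fibSum_hom_ext _ fun y => by simp

/-- The projection of a pushforward onto one summand. -/
noncomputable def pushπ (W : Rp k (ActionGroupoid Y)) (x : ActionGroupoid X) (y : Fib p x.pt) :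
    ((push p).obj W).obj x ⟶ W.obj ⟨y.val⟩ :=
  fibπ W y

/-- The inclusion of one summand in a pushforward. -/
noncomputable def pushι (W : Rp k (ActionGroupoid Y)) (x : ActionGroupoid X) (y : Fib p x.pt) :
    W.obj ⟨y.val⟩ ⟶ ((push p).obj W).obj x :=
  fibι W y

/-- A linear map to a pushforward given by its components. -/
noncomputable def pushLift (W : Rp k (ActionGroupoid Y)) (x : ActionGroupoid X)
    {Z : ModuleCat.{u} k}
    (f : ∀ y : Fib p x.pt, Z ⟶ W.obj ⟨y.val⟩) : Z ⟶ ((push p).obj W).obj x :=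
  Limits.biproduct.lift f

/-- A linear map from a pushforward given by its components. -/
noncomputable def pushDesc (W : Rp k (ActionGroupoid Y)) (x : ActionGroupoid X)
    {Z : ModuleCat.{u} k}
    (f : ∀ y : Fib p x.pt, W.obj ⟨y.val⟩ ⟶ Z) : ((push p).obj W).obj x ⟶ Z :=
  Limits.biproduct.desc f

section

variable (W : Rp k (ActionGroupoid Y)) (x : ActionGroupoid X) {Z : ModuleCat.{u} k}

@[simp]
lemma pushLift_π (f : ∀ y : Fib p x.pt, Z ⟶ W.obj ⟨y.val⟩) (y : Fib p x.pt) :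
    pushLift p W x f ≫ pushπ p W x y = f y :=
  Limits.biproduct.lift_π f y

lemma pushLift_π_assoc (f : ∀ y : Fib p x.pt, Z ⟶ W.obj ⟨y.val⟩) (y : Fib p x.pt)
    {Z' : ModuleCat.{u} k} (h : W.obj ⟨y.val⟩ ⟶ Z') :
    pushLift p W x f ≫ pushπ p W x y ≫ h = f y ≫ h :=
  (Category.assoc _ _ _).symm.trans (congrArg (· ≫ h) (pushLift_π p W x f y))

@[simp]
lemma pushι_desc (f : ∀ y : Fib p x.pt, W.obj ⟨y.val⟩ ⟶ Z) (y : Fib p x.pt) :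
    pushι p W x y ≫ pushDesc p W x f = f y :=
  Limits.biproduct.ι_desc f y

lemma pushι_desc_assoc (f : ∀ y : Fib p x.pt, W.obj ⟨y.val⟩ ⟶ Z) (y : Fib p x.pt)
    {Z' : ModuleCat.{u} k} (h : Z ⟶ Z') :
    pushι p W x y ≫ pushDesc p W x f ≫ h = f y ≫ h :=
  (Category.assoc _ _ _).symm.trans (congrArg (· ≫ h) (pushι_desc p W x f y))

@[simp]
lemma pushι_π (y : Fib p x.pt) : pushι p W x y ≫ pushπ p W x y = 𝟙 _ :=
  Limits.biproduct.ι_π_self _ y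

lemma pushι_π_ne {y y' : Fib p x.pt} (h : y ≠ y') : pushι p W x y ≫ pushπ p W x y' = 0 :=
  Limits.biproduct.ι_π_ne _ h

variable {p W x}

lemma push_hom_ext {f g : Z ⟶ ((push p).obj W).obj x}
    (h : ∀ y, f ≫ pushπ p W x y = g ≫ pushπ p W x y) : f = g :=
  Limits.biproduct.hom_ext _ _ h

lemma push_hom_ext' {f g : ((push p).obj W).obj x ⟶ Z}
    (h : ∀ y, pushι p W x y ≫ f = pushι p W x y ≫ g) : f = g :=
  Limits.biproduct.hom_ext' _ _ h

lemma pushLift_desc (f : ∀ y : Fib p x.pt, Z ⟶ W.obj ⟨y.val⟩) {Z' : ModuleCat.{u} k}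
    (g : ∀ y : Fib p x.pt, W.obj ⟨y.val⟩ ⟶ Z') [Fintype (Fib p x.pt)] :
    pushLift p W x f ≫ pushDesc p W x g = ∑ y, f y ≫ g y := by
  have h : pushLift p W x f = ∑ y, f y ≫ pushι p W x y := by
    refine push_hom_ext fun y => ?_
    rw [Preadditive.sum_comp, pushLift_π, Finset.sum_eq_single y]
    · rw [Category.assoc, pushι_π, Category.comp_id]
    · intro z _ hz
      rw [Category.assoc, pushι_π_ne _ _ _ hz, Limits.comp_zero]
    · simp
  rw [h, Preadditive.sum_comp]
  exact Finset.sum_congr rfl fun y _ => by rw [Category.assoc, pushι_desc]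

end

/-- The relation between `y` and `y'` is a hypothesis, so that no inverse translate appears in the
types when this is applied. -/
lemma push_obj_map_π (W : Rp k (ActionGroupoid Y)) {x x' : ActionGroupoid X} (a : x ⟶ x')
    (y : Fib p x.pt) (y' : Fib p x'.pt) (h : a.val • y.val = y'.val) :
    ((push p).obj W).map a ≫ pushπ p W x' y' = pushπ p W x y ≫
      W.map (agHom (x := ⟨y.val⟩) (y := ⟨y'.val⟩) a.val h) :=
  (fibSumMap_π W a y').trans
    (fibπ_map_congr W (Subtype.ext (inv_smul_eq_iff.2 h.symm)) rfl _ h)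

lemma ι_push_obj_map (W : Rp k (ActionGroupoid Y)) {x x' : ActionGroupoid X} (a : x ⟶ x')
    (y : Fib p x.pt) (y' : Fib p x'.pt) (h : a.val • y.val = y'.val) :
    pushι p W x y ≫ ((push p).obj W).map a =
      W.map (agHom (x := ⟨y.val⟩) (y := ⟨y'.val⟩) a.val h) ≫ pushι p W x' y' :=
  fibι_fibSumMap W a y y' h

lemma ι_push_obj_map_assoc (W : Rp k (ActionGroupoid Y)) {x x' : ActionGroupoid X} (a : x ⟶ x')
    (y : Fib p x.pt) (y' : Fib p x'.pt) (h : a.val • y.val = y'.val) {Z : ModuleCat.{u} k}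
    (g : ((push p).obj W).obj x' ⟶ Z) :
    pushι p W x y ≫ ((push p).obj W).map a ≫ g =
      W.map (agHom (x := ⟨y.val⟩) (y := ⟨y'.val⟩) a.val h) ≫ pushι p W x' y' ≫ g :=
  (Category.assoc _ _ _).symm.trans
    ((congrArg (· ≫ g) (ι_push_obj_map p W a y y' h)).trans (Category.assoc _ _ _))

@[simp]
lemma push_map_π {V W : Rp k (ActionGroupoid Y)} (f : V ⟶ W) (x : ActionGroupoid X)
    (y : Fib p x.pt) :
    ((push p).map f).app x ≫ pushπ p W x y = pushπ p V x y ≫ f.app ⟨y.val⟩ :=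
  Limits.biproduct.map_π (fun y : Fib p x.pt => f.app ⟨y.val⟩) y

@[simp]
lemma ι_push_map {V W : Rp k (ActionGroupoid Y)} (f : V ⟶ W) (x : ActionGroupoid X)
    (y : Fib p x.pt) :
    pushι p V x y ≫ ((push p).map f).app x = f.app ⟨y.val⟩ ≫ pushι p W x y :=
  Limits.biproduct.ι_map (fun y : Fib p x.pt => f.app ⟨y.val⟩) y

lemma ι_push_map_assoc {V W : Rp k (ActionGroupoid Y)} (f : V ⟶ W) (x : ActionGroupoid X)
    (y : Fib p x.pt) {Z : ModuleCat.{u} k} (g : ((push p).obj W).obj x ⟶ Z) :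
    pushι p V x y ≫ ((push p).map f).app x ≫ g = f.app ⟨y.val⟩ ≫ pushι p W x y ≫ g :=
  (Category.assoc _ _ _).symm.trans
    ((congrArg (· ≫ g) (ι_push_map p f x y)).trans (Category.assoc _ _ _))

/-- An element of a fibre, translated. -/
abbrev Fib.translate {x x' : ActionGroupoid X} (a : x ⟶ x') (y : Fib p x.pt) : Fib p x'.pt :=
  ⟨a.val • y.val, by rw [map_smul, y.property, a.property]⟩

lemma Fib.exists_translate {x x' : ActionGroupoid X} (a : x ⟶ x') (y' : Fib p x'.pt) :
    ∃ y : Fib p x.pt, a.val • y.val = y'.val :=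
  ⟨y'.back a.val a.property, y'.smul_back _ _⟩

instance : (push (k := k) p).Additive where
  map_add {V W f g} := by
    ext x : 2
    refine push_hom_ext fun y => ?_
    rw [push_map_π]
    change _ = (((push p).map f).app x + ((push p).map g).app x) ≫ _
    rw [Preadditive.add_comp, push_map_π, push_map_π]
    exact Preadditive.comp_add _ _ _ _ _ _

/-- Transport from the value at a point to the value at the image of an element of its fibre. -/
def toFib (V : Rp k (ActionGroupoid X)) {x : ActionGroupoid X} (y : Fib p x.pt) :
    V.obj x ⟶ ((res k p).obj V).obj ⟨y.val⟩ :=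
  V.map (agHom (y := ⟨FinGSet.toMap p y.val⟩) 1 (by rw [one_smul]; exact y.property.symm))

/-- Transport from the value at the image of an element of a fibre. -/
def ofFib (V : Rp k (ActionGroupoid X)) {x : ActionGroupoid X} (y : Fib p x.pt) :
    ((res k p).obj V).obj ⟨y.val⟩ ⟶ V.obj x :=
  V.map (agHom (x := ⟨FinGSet.toMap p y.val⟩) 1 (by rw [one_smul]; exact y.property))

@[simp]
lemma toFib_ofFib (V : Rp k (ActionGroupoid X)) {x : ActionGroupoid X} (y : Fib p x.pt) :
    toFib p V y ≫ ofFib p V y = 𝟙 _ :=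
  (V.map_comp _ _).symm.trans
    ((congrArg V.map (agHom_self _ (mul_one 1))).trans (V.map_id _))

lemma toFib_self (V : Rp k (ActionGroupoid X)) (y : Y.carrier) :
    toFib p V (x := ⟨FinGSet.toMap p y⟩) ⟨y, rfl⟩ = 𝟙 _ := V.map_id _

lemma ofFib_self (V : Rp k (ActionGroupoid X)) (y : Y.carrier) :
    ofFib p V (x := ⟨FinGSet.toMap p y⟩) ⟨y, rfl⟩ = 𝟙 _ := V.map_id _

lemma map_toFib (V : Rp k (ActionGroupoid X)) {x x' : ActionGroupoid X} (a : x ⟶ x')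
    (y : Fib p x.pt) (y' : Fib p x'.pt) (h : a.val • y.val = y'.val) :
    V.map a ≫ toFib p V y' = toFib p V y ≫
      ((res k p).obj V).map (agHom (x := ⟨y.val⟩) (y := ⟨y'.val⟩) a.val h) :=
  (V.map_comp _ _).symm.trans ((congrArg V.map (Subtype.ext
    ((one_mul _).trans (mul_one _).symm))).trans (V.map_comp _ _))

lemma ofFib_map (V : Rp k (ActionGroupoid X)) {x x' : ActionGroupoid X} (a : x ⟶ x')
    (y : Fib p x.pt) (y' : Fib p x'.pt) (h : a.val • y.val = y'.val) :
    ofFib p V y ≫ V.map a =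
      ((res k p).obj V).map (agHom (x := ⟨y.val⟩) (y := ⟨y'.val⟩) a.val h) ≫ ofFib p V y' :=
  (V.map_comp _ _).symm.trans ((congrArg V.map (Subtype.ext
    ((mul_one _).trans (one_mul _).symm))).trans (V.map_comp _ _))

lemma app_toFib {V V' : Rp k (ActionGroupoid X)} (f : V ⟶ V') {x : ActionGroupoid X}
    (y : Fib p x.pt) :
    f.app x ≫ toFib p V' y = toFib p V y ≫ ((res k p).map f).app ⟨y.val⟩ :=
  (f.naturality _).symm

lemma ofFib_app {V V' : Rp k (ActionGroupoid X)} (f : V ⟶ V') {x : ActionGroupoid X}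
    (y : Fib p x.pt) :
    ofFib p V y ≫ f.app x = ((res k p).map f).app ⟨y.val⟩ ≫ ofFib p V' y :=
  f.naturality _

/-- The unit of the adjunction between restriction and pushforward. -/
noncomputable def pushUnit : 𝟭 (Rp k (ActionGroupoid X)) ⟶ res k p ⋙ push p where
  app V :=
    { app x := pushLift p ((res k p).obj V) x fun y => toFib p V y
      naturality x x' a := push_hom_ext fun y' => by
        obtain ⟨y, h⟩ := Fib.exists_translate p a y'
        dsimp only [Functor.id_obj, Functor.comp_obj]
        rw [Category.assoc, Category.assoc, push_obj_map_π _ _ _ _ _ h, pushLift_π,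
          pushLift_π_assoc, map_toFib _ _ _ _ _ h] }
  naturality V V' f := by
    ext x : 2
    exact push_hom_ext fun y => by
      dsimp only [Functor.id_obj, Functor.comp_obj, Functor.id_map, Functor.comp_map,
        NatTrans.comp_app]
      rw [Category.assoc, Category.assoc, push_map_π, pushLift_π, pushLift_π_assoc, app_toFib]

@[simp]
lemma pushUnit_π (V : Rp k (ActionGroupoid X)) (x : ActionGroupoid X) (y : Fib p x.pt) :
    ((pushUnit p).app V).app x ≫ pushπ p ((res k p).obj V) x y = toFib p V y :=
  pushLift_π _ _ _ _ _

lemma pushUnit_π_assoc (V : Rp k (ActionGroupoid X)) (x : ActionGroupoid X) (y : Fib p x.pt)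
    {Z : ModuleCat.{u} k} (h : ((res k p).obj V).obj ⟨y.val⟩ ⟶ Z) :
    ((pushUnit p).app V).app x ≫ pushπ p ((res k p).obj V) x y ≫ h = toFib p V y ≫ h :=
  (Category.assoc _ _ _).symm.trans (congrArg (· ≫ h) (pushUnit_π p V x y))

/-- The counit of the adjunction between restriction and pushforward. -/
noncomputable def pushCounit : push p ⋙ res k p ⟶ 𝟭 (Rp k (ActionGroupoid Y)) where
  app W :=
    { app y := pushπ p W ((actionMap p).obj y) ⟨y.pt, rfl⟩
      naturality y y' a := push_obj_map_π p W ((actionMap p).map a) ⟨y.pt, rfl⟩ ⟨y'.pt, rfl⟩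
        a.property }
  naturality W W' f := by
    ext y : 2
    exact push_map_π p f _ _

/-- Pushforward is right adjoint to restriction. -/
noncomputable def resPushAdj : res k p ⊣ push p :=
  Adjunction.mkOfUnitCounit
    { unit := pushUnit p
      counit := pushCounit p
      left_triangle := by
        ext V y : 4
        refine (congrArg (_ ≫ ·) (Category.id_comp _)).trans ?_
        exact (pushUnit_π p V _ ⟨y.pt, rfl⟩).trans (toFib_self p V y.pt)
      right_triangle := by
        ext W x : 4
        refine (congrArg (_ ≫ ·) (Category.id_comp _)).trans ?_
        refine push_hom_ext fun y => ?_
        refine (Category.assoc _ _ _).trans ?_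
        refine (congrArg (_ ≫ ·) (push_map_π p _ _ _)).trans ?_
        refine (pushUnit_π_assoc p _ _ _ _).trans ?_
        refine (push_obj_map_π p W _ y ⟨y.val, rfl⟩ (one_smul _ _)).trans ?_
        exact (congrArg (_ ≫ ·) (W.map_id _)).trans ((Category.comp_id _).trans
          (Category.id_comp _).symm) }

/-- The unit of the adjunction between pushforward and restriction. -/
noncomputable def copushUnit : 𝟭 (Rp k (ActionGroupoid Y)) ⟶ push p ⋙ res k p where
  app W :=
    { app y := pushι p W ((actionMap p).obj y) ⟨y.pt, rfl⟩
      naturality y y' a :=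
        (ι_push_obj_map p W ((actionMap p).map a) ⟨y.pt, rfl⟩ ⟨y'.pt, rfl⟩ a.property).symm }
  naturality W W' f := by
    ext y : 2
    exact (ι_push_map p f _ _).symm

/-- The counit of the adjunction between pushforward and restriction: the trace. -/
noncomputable def copushCounit : res k p ⋙ push p ⟶ 𝟭 (Rp k (ActionGroupoid X)) where
  app V :=
    { app x := pushDesc p ((res k p).obj V) x fun y => ofFib p V y
      naturality x x' a := push_hom_ext' fun y => by
        dsimp only [Functor.id_obj, Functor.comp_obj]
        rw [ι_push_obj_map_assoc _ _ _ _ (y.translate p a) rfl, pushι_desc,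
          pushι_desc_assoc, ofFib_map _ _ _ _ (y.translate p a) rfl] }
  naturality V V' f := by
    ext x : 2
    exact push_hom_ext' fun y => by
      dsimp only [Functor.id_obj, Functor.comp_obj, Functor.id_map, Functor.comp_map,
        NatTrans.comp_app]
      rw [ι_push_map_assoc, pushι_desc, pushι_desc_assoc, ofFib_app]

@[simp]
lemma ι_copushCounit (V : Rp k (ActionGroupoid X)) (x : ActionGroupoid X) (y : Fib p x.pt) :
    pushι p ((res k p).obj V) x y ≫ ((copushCounit p).app V).app x = ofFib p V y :=
  pushι_desc _ _ _ _ _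

/-- Pushforward is left adjoint to restriction. -/
noncomputable def pushResAdj : push p ⊣ res k p :=
  Adjunction.mkOfUnitCounit
    { unit := copushUnit p
      counit := copushCounit p
      left_triangle := by
        ext W x : 4
        refine (congrArg (_ ≫ ·) (Category.id_comp _)).trans ?_
        refine push_hom_ext' fun y => ?_
        refine (ι_push_map_assoc p _ _ _ _).trans ?_
        refine (congrArg (_ ≫ ·) (ι_copushCounit p _ _ _)).trans ?_
        refine (ι_push_obj_map p W _ ⟨y.val, rfl⟩ y (one_smul _ _)).trans ?_
        exact (congrArg (· ≫ _) (W.map_id _)).trans ((Category.id_comp _).trans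
          (Category.comp_id _).symm)
      right_triangle := by
        ext V y : 4
        refine (congrArg (_ ≫ ·) (Category.id_comp _)).trans ?_
        exact (ι_copushCounit p V _ ⟨y.pt, rfl⟩).trans (ofFib_self p V y.pt) }

end Pushforward
end StackRep

namespace StackRep
-- Formal descent along a functor with split unit
section Descent

variable {C D : Type*} [Category* C] [Category* D] {F : C ⥤ D} {R : D ⥤ C} (adj : F ⊣ R)
  (s : F ⋙ R ⟶ 𝟭 C)

section

variable {W : D} (ρ : W ⟶ F.obj (R.obj W))

/-- Naturality of `s` turns the two sides into `R` of the two sides of `h2`, each followed by `s`.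
In other words, averaging lands in the coinvariant part, where the coaction agrees with the unit. -/
lemma coaction_averaging_comp
    (h2 : ρ ≫ F.map (R.map ρ) = ρ ≫ F.map (adj.unit.app (R.obj W))) :
    (R.map ρ ≫ s.app (R.obj W)) ≫ R.map ρ =
      (R.map ρ ≫ s.app (R.obj W)) ≫ adj.unit.app (R.obj W) := by
  have h3 := s.naturality (R.map ρ)
  have h4 := s.naturality (adj.unit.app (R.obj W))
  dsimp at h3 h4
  rw [Category.assoc, Category.assoc, ← h3, ← h4, ← R.map_comp_assoc, ← R.map_comp_assoc, h2]

/-- The averaging endomorphism defined by a coaction is idempotent. -/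
lemma coaction_averaging_idem
    (hs : ∀ X, adj.unit.app X ≫ s.app X = 𝟙 X)
    (h2 : ρ ≫ F.map (R.map ρ) = ρ ≫ F.map (adj.unit.app (R.obj W))) :
    (R.map ρ ≫ s.app (R.obj W)) ≫ R.map ρ ≫ s.app (R.obj W) = R.map ρ ≫ s.app (R.obj W) := by
  rw [← Category.assoc, coaction_averaging_comp adj s ρ h2, Category.assoc, hs]
  exact Category.comp_id _

/-- Descent along a functor whose unit is split: an object with a coaction is in the image of the
functor as soon as its averaging idempotent splits. -/
lemma nonempty_iso_of_coaction
    (hs : ∀ X, adj.unit.app X ≫ s.app X = 𝟙 X)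
    (h2 : ρ ≫ F.map (R.map ρ) = ρ ≫ F.map (adj.unit.app (R.obj W)))
    (h1 : ρ ≫ adj.counit.app W = 𝟙 W)
    {V : C} (r : R.obj W ⟶ V) (i : V ⟶ R.obj W) (hir : i ≫ r = 𝟙 V)
    (hri : r ≫ i = R.map ρ ≫ s.app (R.obj W)) : Nonempty (F.obj V ≅ W) := by
  -- The splitting object inherits the equalizing property of the averaging map, since `i = i ≫ r ≫
  -- i`.
  have hi : i ≫ R.map ρ = i ≫ adj.unit.app (R.obj W) := by
    have : i = i ≫ r ≫ i := by rw [← Category.assoc, hir, Category.id_comp]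
    rw [this, hri, Category.assoc, coaction_averaging_comp adj s ρ h2, Category.assoc]
    simp only [Category.assoc]
  refine ⟨⟨F.map i ≫ adj.counit.app W, ρ ≫ F.map r, ?_, ?_⟩⟩
  · have h3 := adj.counit.naturality ρ
    dsimp at h3
    rw [Category.assoc, ← reassoc_of% h3, ← F.map_comp_assoc, hi, F.map_comp_assoc,
      adj.left_triangle_components_assoc, ← F.map_comp, hir, F.map_id]
  · rw [Category.assoc, ← F.map_comp_assoc, hri, F.map_comp, Category.assoc, reassoc_of% h2,
      ← F.map_comp_assoc, hs, F.map_id, Category.id_comp, h1]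

end

/-- The unit and `s` exhibit `f` as a retract of `R (F f)`, and retracts of isomorphisms are
isomorphisms. -/
lemma isIso_of_isIso_map
    (hs : ∀ X, adj.unit.app X ≫ s.app X = 𝟙 X)
    {X Y : C} (f : X ⟶ Y) [IsIso (F.map f)] : IsIso f := by
  have h1 := s.naturality f
  have h2 := adj.unit.naturality f
  dsimp at h1 h2
  refine ⟨adj.unit.app Y ≫ R.map (inv (F.map f)) ≫ s.app X, ?_, ?_⟩
  · rw [reassoc_of% h2, ← R.map_comp_assoc, IsIso.hom_inv_id, R.map_id, Category.id_comp, hs]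
  · rw [Category.assoc, Category.assoc, ← h1, ← R.map_comp_assoc, IsIso.inv_hom_id, R.map_id,
      Category.id_comp, hs]

end Descent

/-! ### Adjunctions on stable categories -/

section Stable

variable {A B : Type*} [Category* A] [Preadditive A] [Category* B] [Preadditive B]
  {F : A ⥤ B} [F.Additive] [F.PreservesProjectiveObjects]
  {R : B ⥤ A} [R.Additive] [R.PreservesProjectiveObjects]

/-- The natural transformation of stable functors defined by `F ⋙ R ⟶ 𝟭`. -/
def stableToId (s : F ⋙ R ⟶ 𝟭 A) : stableMap F ⋙ stableMap R ⟶ 𝟭 (Stable A) where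
  app X := (toStable A).map (s.app X.as)
  naturality X Y f := by
    obtain ⟨f, rfl⟩ := (toStable A).map_surjective (X := X.as) (Y := Y.as) f
    exact congrArg (toStable A).map (s.naturality f)

/-- The natural transformation of stable functors defined by `𝟭 ⟶ F ⋙ R`. -/
def stableFromId (s : 𝟭 A ⟶ F ⋙ R) : 𝟭 (Stable A) ⟶ stableMap F ⋙ stableMap R where
  app X := (toStable A).map (s.app X.as)
  naturality X Y f := by
    obtain ⟨f, rfl⟩ := (toStable A).map_surjective (X := X.as) (Y := Y.as) f
    exact congrArg (toStable A).map (s.naturality f)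

/-- An adjunction induces an adjunction of stable functors. -/
def stableAdj (adj : F ⊣ R) : stableMap F ⊣ stableMap R :=
  Adjunction.mkOfUnitCounit
    { unit := stableFromId adj.unit
      counit := stableToId adj.counit
      left_triangle := by
        ext X
        refine (congrArg (_ ≫ ·) (Category.id_comp _)).trans ?_
        exact congrArg (toStable B).map (adj.left_triangle_components X.as)
      right_triangle := by
        ext X
        refine (congrArg (_ ≫ ·) (Category.id_comp _)).trans ?_
        exact congrArg (toStable A).map (adj.right_triangle_components X.as) }

lemma toStable_map_eq_iff [Limits.HasZeroObject A] [Limits.HasBinaryBiproducts A] {X Y : A}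
    (f g : X ⟶ Y) : (toStable A).map f = (toStable A).map g ↔ stableRel A f g :=
  CategoryTheory.Quotient.functor_map_eq_iff _ f g

end Stable

/-! ### Pushforward on stable categories and the averaged trace -/

section PushStable

variable (k : Type u) [Field k] {G : Type v} [Group G] {X Y : FinGSet.{v} G} (p : Y ⟶ X)

instance : (res k p).PreservesEpimorphisms where
  preserves f hf := by
    have (y : ActionGroupoid Y) : Epi (((res k p).map f).app y) :=
      inferInstanceAs (Epi (f.app ((actionMap p).obj y)))
    exact NatTrans.epi_of_epi_app _

/-- Here pushforward is used as a left adjoint; the descent argument uses it as a right adjoint. -/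
instance : (push (k := k) p).PreservesProjectiveObjects :=
  Functor.preservesProjectiveObjects_of_adjunction_of_preservesEpimorphisms (pushResAdj p)

/-- Each element of the fibre contributes a transport there and back, that is, one identity. -/
lemma pushUnit_copushCounit [Fintype Y.carrier] [DecidableEq X.carrier]
    (V : Rp k (ActionGroupoid X)) (x : ActionGroupoid X) :
    ((pushUnit p).app V).app x ≫ ((copushCounit p).app V).app x =
      (Fintype.card (Fib p x.pt) : k) • 𝟙 (V.obj x) := by
  refine (pushLift_desc _ _).trans ?_
  rw [Finset.sum_congr rfl fun y _ => toFib_ofFib p V y, Finset.sum_const, Finset.card_univ,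
    Nat.cast_smul_eq_nsmul]

/-- The trace divided by the cardinality `n` of the fibres. -/
noncomputable def averagedTrace (n : k) : res k p ⋙ push p ⟶ 𝟭 (Rp k (ActionGroupoid X)) where
  app V := n⁻¹ • (copushCounit p).app V
  naturality V W f := by
    rw [Linear.comp_smul, (copushCounit p).naturality, Linear.smul_comp]

lemma pushUnit_averagedTrace {n : ℕ} (hn : (n : k) ≠ 0) (h : ∀ x, Nat.card (Fib p x) = n)
    (V : Rp k (ActionGroupoid X)) :
    (pushUnit p).app V ≫ (averagedTrace k p n).app V = 𝟙 V := by
  classical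
  have := Fintype.ofFinite Y.carrier
  ext x : 2
  change _ ≫ ((n : k)⁻¹ • (copushCounit p).app V).app x = _
  rw [show ((n : k)⁻¹ • (copushCounit p).app V).app x = (n : k)⁻¹ • ((copushCounit p).app V).app x
    from rfl]
  refine (Linear.comp_smul _ _ _ _ _ _).trans ?_
  rw [pushUnit_copushCounit, ← Nat.card_eq_fintype_card, h, smul_smul, inv_mul_cancel₀ hn, one_smul]
  rfl

end PushStable
end StackRep

namespace StackRep
-- Splitting stable idempotents on finite-dimensional representations
section Idempotents

open Polynomial in
/-- An integral element `a` over a field has a polynomial multiple `e = q(a) a` that is idempotent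
and such that `a` is nilpotent on the complement. -/
lemma exists_fitting_idempotent {k A : Type*} [Field k] [Ring A] [Algebra k A] {a : A}
    (ha : IsIntegral k a) : ∃ (q : k[X]) (m : ℕ),
      IsIdempotentElem (aeval a (X * q)) ∧ aeval a (X ^ (m + 1) * (1 - X * q)) = 0 := by
  obtain ⟨f, hf, hdvd⟩ := (minpoly k a).exists_eq_pow_rootMultiplicity_mul_and_not_dvd
    (minpoly.ne_zero ha) 0
  set m := (minpoly k a).rootMultiplicity 0
  rw [C_0, sub_zero] at hf hdvd
  -- The exponent is `m + 1` so that a factor `X` splits off even for `m = 0`: with `q = x * X ^ m`,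
  -- the product `X * q` is 0 modulo `X ^ (m + 1)` and 1 modulo `f`, hence idempotent modulo `X ^ m
  -- * f`.
  have hc : IsCoprime (X ^ (m + 1)) f :=
    ((irreducible_X (R := k)).coprime_iff_not_dvd.2 hdvd).pow_left
  obtain ⟨x, y, hxy⟩ := hc
  have h0 (g : k[X]) : aeval a (g * (X ^ m * f)) = 0 := by
    rw [← hf, map_mul, minpoly.aeval, mul_zero]
  have e1 : X * (x * X ^ m) * (X * (x * X ^ m)) = X * (x * X ^ m) - x * y * X * (X ^ m * f) := by
    linear_combination (X * x * X ^ m) * hxy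
  have e2 : X ^ (m + 1) * (1 - X * (x * X ^ m)) = y * X * (X ^ m * f) := by
    linear_combination (-X ^ (m + 1)) * hxy
  refine ⟨x * X ^ m, m, ?_, ?_⟩
  · have := congrArg (aeval a) e1
    rwa [map_mul, map_sub, h0, sub_zero] at this
  · rw [e2, h0]

variable (k : Type u) [Field k] {C : Type w} [Groupoid.{v} C]

/-- The representations with finite-dimensional values. -/
def FinVal (V : Rp k C) : Prop := ∀ c, Module.Finite k (V.obj c)

variable {k}

lemma FinVal.of_retract {V W : Rp k C} (h : FinVal k V) (i : W ⟶ V) (r : V ⟶ W)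
    (hir : i ≫ r = 𝟙 W) : FinVal k W := fun c => by
  have := h c
  refine Module.Finite.of_surjective (r.app c).hom fun x => ⟨i.app c x, ?_⟩
  exact ConcreteCategory.congr_hom (NatTrans.congr_app hir c) x

lemma FinVal.finite_hom [Finite C] {V W : Rp k C} (hV : FinVal k V) (hW : FinVal k W) :
    Module.Finite k (V ⟶ W) := by
  have := Fintype.ofFinite C
  have : ∀ c, Module.Finite k (V.obj c) := hV
  have : ∀ c, Module.Finite k (W.obj c) := hW
  have (c : C) : Module.Finite k (V.obj c →ₗ[k] W.obj c) := inferInstance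
  let φ : (V ⟶ W) →ₗ[k] ∀ c, V.obj c →ₗ[k] W.obj c :=
    { toFun f c := (f.app c).hom
      map_add' _ _ := rfl
      map_smul' _ _ := rfl }
  have : IsNoetherian k (∀ c, V.obj c →ₗ[k] W.obj c) := isNoetherian_pi
  refine Module.Finite.of_injective φ fun f g h => ?_
  exact NatTrans.ext (funext fun c => ModuleCat.hom_ext (congrFun h c))

/-- The endomorphisms that factor through a projective object. -/
def stableIdeal (V : Rp k C) : Ideal (End V) where
  carrier := { f | ∃ (P : Rp k C) (_ : Projective P) (a : V ⟶ P) (b : P ⟶ V), f = a ≫ b }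
  zero_mem' := ⟨_, Projective.zero_projective, 0, 0, by simp⟩
  add_mem' := by
    rintro f g ⟨P, hP, a, b, h⟩ ⟨Q, hQ, c, d, h'⟩
    refine ⟨P ⊞ Q, inferInstance, Limits.biprod.lift a c, Limits.biprod.desc b d, ?_⟩
    rw [Limits.biprod.lift_desc, h, h']
  smul_mem' f := by
    rintro g ⟨P, hP, a, b, h⟩
    exact ⟨P, hP, a, b ≫ f, by rw [h, ← Category.assoc]; rfl⟩

lemma mem_stableIdeal_iff {V : Rp k C} {f : End V} : f ∈ stableIdeal V ↔
    ∃ (P : Rp k C) (_ : Projective P) (a : V ⟶ P) (b : P ⟶ V), f = a ≫ b := Iff.rfl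

open Polynomial in
/-- Stable idempotents on finite-dimensional representations split. -/
lemma FinVal.exists_split [Finite C] {V : Rp k C} (hV : FinVal k V) (a : V ⟶ V)
    (ha : (toStable (Rp k C)).map (a ≫ a) = (toStable (Rp k C)).map a) :
    ∃ (Y : Rp k C) (i : Y ⟶ V) (r : V ⟶ Y), FinVal k Y ∧ i ≫ r = 𝟙 Y ∧
      (toStable (Rp k C)).map (r ≫ i) = (toStable (Rp k C)).map a := by
  have := hV.finite_hom hV
  have : Module.Finite k (End V) := this
  let α : End V := a
  obtain ⟨q, m, he, hm⟩ := exists_fitting_idempotent (Algebra.IsIntegral.isIntegral (R := k) α)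
  -- In the commutative quotient `k[X] / J` the class of `X` is idempotent. Then `X ^ (m + 1) * (1 -
  -- X * q) = 0` reduces to `X = X * q`, so the honest idempotent given by `X * q` is stably equal
  -- to `a`.
  let J : Ideal k[X] := (stableIdeal V).comap (aeval α)
  have h1 : X * X - X ∈ J := by
    change aeval α (X * X - X) ∈ stableIdeal V
    obtain ⟨P, hP, b, c, h⟩ := (toStable_map_eq_iff _ _).1 ha
    refine mem_stableIdeal_iff.2 ⟨P, hP, b, c, ?_⟩
    rw [← h]
    simp only [map_sub, map_mul, aeval_X]
    rfl
  have h2 : X ^ (m + 1) * (1 - X * q) ∈ J := by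
    change aeval α _ ∈ stableIdeal V
    rw [hm]
    exact Ideal.zero_mem _
  have h3 : X * q - X ∈ J := by
    have h1' : IsIdempotentElem (Ideal.Quotient.mk J X) := by
      rw [IsIdempotentElem, ← map_mul]
      exact Ideal.Quotient.eq.2 h1
    have h2' := Ideal.Quotient.eq_zero_iff_mem.2 h2
    rw [map_mul, map_pow, h1'.pow_succ_eq, map_sub, map_one, map_mul] at h2'
    apply Ideal.Quotient.eq.1
    rw [map_mul]
    have h4 : Ideal.Quotient.mk J X * Ideal.Quotient.mk J X = Ideal.Quotient.mk J X := h1'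
    linear_combination -(Ideal.Quotient.mk J q) * h4 - h2'
  let e : V ⟶ V := aeval α (X * q)
  obtain ⟨Y, i, r, hir, hri⟩ := IsIdempotentComplete.idempotents_split V e he
  refine ⟨Y, i, r, hV.of_retract i r hir, hir, ?_⟩
  rw [hri, toStable_map_eq_iff]
  obtain ⟨P, hP, b, c, h⟩ := mem_stableIdeal_iff.1
    (show aeval α (X * q - X) ∈ stableIdeal V from h3)
  refine ⟨P, hP, b, c, ?_⟩
  rw [← h]
  simp only [map_sub, aeval_X]
  rfl

end Idempotents
end StackRep

namespace StackRep
-- Invertible objects are stably finite-dimensional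
section FiniteInvertible

variable {k : Type u} [Field k] {K : Type v} [Group K]

/-- The subrepresentation given by a stable subspace. -/
def subRep (V : Rp k (SingleObj K)) (P : Submodule k (V.obj (SingleObj.star K)))
    (hP : ∀ g : SingleObj.star K ⟶ SingleObj.star K, P ≤ P.comap (V.map g).hom) :
    Rp k (SingleObj K) where
  obj _ := ModuleCat.of k P
  map g := ModuleCat.ofHom ((V.map g).hom.restrict (hP g))
  map_id _ := by
    refine ModuleCat.hom_ext (LinearMap.ext fun x => Subtype.ext ?_)
    exact ConcreteCategory.congr_hom (V.map_id _) x.val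
  map_comp f g := by
    refine ModuleCat.hom_ext (LinearMap.ext fun x => Subtype.ext ?_)
    exact ConcreteCategory.congr_hom (V.map_comp f g) x.val

/-- The inclusion of a subrepresentation. -/
def subRepι (V : Rp k (SingleObj K)) (P : Submodule k (V.obj (SingleObj.star K)))
    (hP : ∀ g : SingleObj.star K ⟶ SingleObj.star K, P ≤ P.comap (V.map g).hom) :
    subRep V P hP ⟶ V where
  app _ := ModuleCat.ofHom P.subtype
  naturality _ _ _ := rfl

lemma exists_stable_submodule [Finite K] (V : Rp k (SingleObj K))
    (P : Submodule k (V.obj (SingleObj.star K))) (h : P.FG) :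
    ∃ Q : Submodule k (V.obj (SingleObj.star K)), P ≤ Q ∧ Q.FG ∧
      ∀ g : SingleObj.star K ⟶ SingleObj.star K, Q ≤ Q.comap (V.map g).hom := by
  have : Finite (SingleObj.star K ⟶ SingleObj.star K) := inferInstanceAs (Finite K)
  refine ⟨⨆ g : SingleObj.star K ⟶ SingleObj.star K, P.map (V.map g).hom, ?_,
    Submodule.fg_iSup _ fun g => h.map _, fun g => ?_⟩
  · refine le_trans ?_ (le_iSup _ (𝟙 _))
    rw [V.map_id]
    intro x hx
    exact ⟨x, hx, rfl⟩
  · refine iSup_le fun f => ?_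
    rintro _ ⟨x, hx, rfl⟩
    refine Submodule.mem_iSup_of_mem (f ≫ g) ⟨x, hx, ?_⟩
    rw [V.map_comp]
    rfl

/-- A map from the unit is an invariant tensor. It involves finitely many vectors of `V`, and their
translates under the finite group `K` still span a finite-dimensional space. -/
lemma exists_factorization_through_finVal [Finite K] {V V' : Rp k (SingleObj K)}
    (a : 𝟙_ (Rp k (SingleObj K)) ⟶ V ⊗ V') :
    ∃ (V₀ : Rp k (SingleObj K)) (i : V₀ ⟶ V) (a₀ : 𝟙_ _ ⟶ V₀ ⊗ V'), FinVal k V₀ ∧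
      a₀ ≫ i ▷ V' = a := by
  let t : TensorProduct k (V.obj (SingleObj.star K)) (V'.obj (SingleObj.star K)) :=
    (a.app (SingleObj.star K)).hom (1 : k)
  obtain ⟨P, hP, ht⟩ := TensorProduct.exists_finite_submodule_left_of_setFinite {t}
    (Set.finite_singleton t)
  obtain ⟨Q, hPQ, hQ, hs⟩ := exists_stable_submodule V P (Module.Finite.iff_fg.1 hP)
  have ht' : t ∈ LinearMap.range (Q.subtype.rTensor (V'.obj (SingleObj.star K))) := by
    obtain ⟨y, hy⟩ := ht rfl
    refine ⟨(Submodule.inclusion hPQ).rTensor _ y, ?_⟩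
    rw [← hy, ← LinearMap.comp_apply, ← LinearMap.rTensor_comp]
    rfl
  obtain ⟨t₀, ht₀⟩ := ht'
  -- By flatness over a field, invariance of the lifted tensor can be tested in `V ⊗ V'`.
  have hmono : Mono (subRepι V Q hs ▷ V') := by
    have (c : SingleObj K) : Mono ((subRepι V Q hs ▷ V').app c) := by
      rw [ModuleCat.mono_iff_injective]
      exact Module.Flat.rTensor_preserves_injective_linearMap Q.subtype Q.subtype_injective
    exact NatTrans.mono_of_mono_app _
  let b : (𝟙_ (Rp k (SingleObj K))).obj (SingleObj.star K) ⟶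
    (subRep V Q hs ⊗ V').obj (SingleObj.star K) :=
      ModuleCat.ofHom (LinearMap.toSpanSingleton k _ t₀)
  have hb : b ≫ (subRepι V Q hs ▷ V').app (SingleObj.star K) = a.app (SingleObj.star K) := by
    refine ModuleCat.hom_ext (LinearMap.ext_ring ?_)
    refine Eq.trans ?_ ht₀
    change Q.subtype.rTensor _ ((1 : k) • t₀) = _
    rw [one_smul]
  refine ⟨subRep V Q hs, subRepι V Q hs, ⟨fun _ => b, ?_⟩, fun _ => Module.Finite.iff_fg.2 hQ, ?_⟩
  · rintro ⟨⟩ ⟨⟩ f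
    have h1 : Mono ((subRepι V Q hs ▷ V').app (SingleObj.star K)) := inferInstance
    rw [← cancel_mono ((subRepι V Q hs ▷ V').app (SingleObj.star K)), Category.assoc,
      Category.assoc]
    have h2 := (subRepι V Q hs ▷ V').naturality f
    have h3 := a.naturality f
    refine (congrArg (_ ≫ ·) hb).trans ?_
    refine h3.trans ?_
    refine Eq.trans ?_ (congrArg (b ≫ ·) h2).symm
    rw [← Category.assoc]
    exact congrArg (· ≫ _) hb.symm
  · ext ⟨⟩ : 2
    exact hb

/-- If the unit maps isomorphically to `V ⊗ V'` through `V₀ ⊗ V'`, then `V` is a retract of `V₀`. -/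
lemma retract_of_factorization {A : Type*} [Category* A] [MonoidalCategory A] {V V' V₀ : A}
    (e : 𝟙_ A ≅ V ⊗ V') (f : V' ⊗ V ≅ 𝟙_ A) (i : V₀ ⟶ V) (a₀ : 𝟙_ A ⟶ V₀ ⊗ V')
    (h : a₀ ≫ i ▷ V' = e.hom) : ∃ (s : V ⟶ V₀) (r : V₀ ⟶ V), s ≫ r = 𝟙 V := by
  -- Since `e` and `f` need not be compatible, the zigzag is only an automorphism `u` of `V`; the
  -- retraction is corrected by its inverse.
  let u : V ≅ V := (λ_ V).symm ≪≫ whiskerRightIso e V ≪≫ α_ _ _ _ ≪≫ whiskerLeftIso V f ≪≫ ρ_ V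
  refine ⟨(λ_ V).inv ≫ a₀ ▷ V ≫ (α_ _ _ _).hom ≫ V₀ ◁ f.hom ≫ (ρ_ V₀).hom, i ≫ u.inv, ?_⟩
  rw [← Category.assoc, Iso.comp_inv_eq, Category.id_comp]
  simp only [u, Iso.trans_hom, Iso.symm_hom, whiskerRightIso_hom, whiskerLeftIso_hom, ← h,
    comp_whiskerRight, Category.assoc, associator_naturality_left_assoc]
  rw [← rightUnitor_naturality, ← whisker_exchange_assoc]

/-- A lift of `e.inv` to an honest morphism factors through a finite-dimensional `V₀`, so `V` is a
stable retract of `V₀`. The resulting stable idempotent splits off an honest summand, which is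
stably isomorphic to `V`. -/
lemma exists_finVal_of_tensorInvertible [Finite K] (V : StRp k (SingleObj K))
    (hV : TensorInvertible V) :
    ∃ Y : Rp k (SingleObj K), FinVal k Y ∧ Nonempty (V ≅ (toStable _).obj Y) := by
  obtain ⟨V', ⟨e⟩, ⟨f⟩⟩ := hV
  obtain ⟨a, ha⟩ := (toStable (Rp k (SingleObj K))).map_surjective (X := 𝟙_ _) (Y := V.as ⊗ V'.as)
    e.inv
  obtain ⟨V₀, i, a₀, hV₀, h⟩ := exists_factorization_through_finVal a
  obtain ⟨s, r, hsr⟩ := retract_of_factorization e.symm f ((toStable _).map i)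
    ((toStable _).map a₀) ((congrArg (toStable _).map h).trans ha)
  obtain ⟨b, hb⟩ := (toStable (Rp k (SingleObj K))).map_surjective (X := V₀) (Y := V₀) (r ≫ s)
  obtain ⟨Y, j, q, hY, hjq, hqj⟩ := hV₀.exists_split b (by
    rw [Functor.map_comp, hb, Category.assoc, reassoc_of% hsr])
  have hjq' := congrArg (toStable _).map hjq
  rw [Functor.map_comp, hb] at hqj
  rw [Functor.map_comp, CategoryTheory.Functor.map_id] at hjq'
  refine ⟨Y, hY, ⟨⟨s ≫ (toStable _).map q, (toStable _).map j ≫ r, ?_, ?_⟩⟩⟩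
  · rw [Category.assoc, reassoc_of% hqj, hsr, Category.comp_id, hsr]
  · rw [Category.assoc, ← Category.assoc r, ← hqj, Category.assoc, hjq', Category.comp_id, hjq']

end FiniteInvertible
end StackRep

namespace StackRep
-- Duals and detection of invertibility
section Duals

variable {k : Type u} [Field k] {C : Type w} [Groupoid.{v} C]

/-- Functors from a groupoid to the rigid category of finite-dimensional spaces have duals; the
inclusion into all representations is monoidal and transports the pairing. -/
lemma FinVal.exists_exactPairing {V : Rp k C} (hV : FinVal k V) :
    ∃ V' : Rp k C, Nonempty (ExactPairing V V') := by
  let W : C ⥤ FGModuleCat.{u} k := (ModuleCat.isFG k).lift V hV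
  let F : (C ⥤ FGModuleCat.{u} k) ⥤ Rp k C :=
    (Functor.whiskeringRight C _ _).obj (ModuleCat.isFG k).ι
  exact ⟨F.obj Wᘁ, ⟨exactPairingMap F W Wᘁ⟩⟩

instance : (toStable (Rp k C)).Monoidal :=
  Functor.CoreMonoidal.toMonoidal
    { εIso := Iso.refl _
      μIso X Y := Iso.refl _
      μIso_hom_natural_left f X := by simp; rfl
      μIso_hom_natural_right f X := by simp; rfl
      associativity := by intros; simp; rfl
      left_unitality := by intros; simp; rfl
      right_unitality := by intros; simp; rfl }

/-- For an object with a dual, invertibility amounts to the evaluation being an isomorphism, and `F`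
detects this. -/
lemma tensorInvertible_of_map {B : Type*} [Category* B] [MonoidalCategory B]
    {A : Type*} [Category* A] [MonoidalCategory A] [SymmetricCategory A] (F : A ⥤ B) [F.Monoidal]
    [F.ReflectsIsomorphisms] {V V' : A} [ExactPairing V V'] (h : TensorInvertible (F.obj V)) :
    TensorInvertible V := by
  let _ := exactPairingMap F V V'
  have h1 : IsIso (ε_ (F.obj V) (F.obj V')) := isIso_evaluation_of_tensorInvertible h
  have h2 : ε_ (F.obj V) (F.obj V') =
    Functor.LaxMonoidal.μ F V' V ≫ F.map (ε_ V V') ≫ Functor.OplaxMonoidal.η F := rfl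
  have h3 : F.map (ε_ V V') = Functor.OplaxMonoidal.δ F V' V ≫ ε_ (F.obj V) (F.obj V') ≫
      Functor.LaxMonoidal.ε F := by
    rw [h2]; simp
  have h4 : IsIso (F.map (ε_ V V')) := by rw [h3]; infer_instance
  have h5 : IsIso (ε_ V V') := isIso_of_reflects_iso _ F
  exact ⟨V', ⟨β_ V V' ≪≫ asIso (ε_ V V')⟩, ⟨asIso (ε_ V V')⟩⟩

end Duals

/-! ### Comparison with groups of endotrivial modules -/

section Endotrivial

variable (k : Type u) [Field k] (K : Type v) [Group K] [Finite K]

/-- Injectivity is fullness of the subcategory. For surjectivity, the inverse must be replaced by a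
finite-dimensional object as well. -/
lemma EndoT.incl_bijective : Function.Bijective (EndoT.incl k K) := by
  constructor
  · intro w w' h
    obtain ⟨V, hV⟩ := Pic.exists_rep w
    obtain ⟨V', hV'⟩ := Pic.exists_rep w'
    have h1 := congrArg Units.val h
    rw [EndoT.incl, Pic.map_val _ _ hV, Pic.map_val _ _ hV', toSkeleton_eq_toSkeleton_iff] at h1
    obtain ⟨e⟩ := h1
    ext
    rw [hV, hV']
    exact congr_toSkeleton_of_iso ((finDim k K).isoMk e)
  · intro w
    obtain ⟨V, hV⟩ := Pic.exists_rep w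
    obtain ⟨V', hV'⟩ := Pic.exists_rep w⁻¹
    obtain ⟨Y, hY, ⟨e⟩⟩ := exists_finVal_of_tensorInvertible V (Pic.tensorInvertible hV)
    obtain ⟨Y', hY', ⟨e'⟩⟩ := exists_finVal_of_tensorInvertible V' (Pic.tensorInvertible hV')
    let Z : FinStab k K := ⟨(toStable _).obj Y, hY (SingleObj.star K)⟩
    let Z' : FinStab k K := ⟨(toStable _).obj Y', hY' (SingleObj.star K)⟩
    have h1 : Nonempty (Z.obj ⊗ Z'.obj ≅ 𝟙_ _) := by
      rw [← toSkeleton_eq_toSkeleton_iff, Skeleton.toSkeleton_tensorObj,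
        ← congr_toSkeleton_of_iso e, ← congr_toSkeleton_of_iso e', ← hV, ← hV']
      exact w.mul_inv
    obtain ⟨f⟩ := h1
    have hZ : TensorInvertible Z :=
      ⟨Z', ⟨(finDim k K).isoMk f⟩, ⟨(finDim k K).isoMk (β_ _ _ ≪≫ f)⟩⟩
    obtain ⟨z, hz⟩ := isUnit_toSkeleton_iff.2 hZ
    refine ⟨z, ?_⟩
    ext
    rw [EndoT.incl, Pic.map_val _ _ hz, hV]
    exact congr_toSkeleton_of_iso e.symm

lemma Pic.map_stRes_bijective {C D : Type*} [Groupoid C] [Groupoid D] [EssentiallySmall.{u} C]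
    [EssentiallySmall.{u} D] [LocallySmall.{u} C]
    [LocallySmall.{u} D] (F : C ⥤ D) [F.Faithful] [F.IsEquivalence] :
    Function.Bijective (Pic.map (stRes k F)) := by
  refine Pic.map_bijective_of_inverse _ (stRes k F.inv) (fun V => ?_) (fun V => ?_)
  · exact ⟨(toStable _).mapIso (Functor.isoWhiskerRight F.asEquivalence.counitIso V.as)⟩
  · exact ⟨(toStable _).mapIso (Functor.isoWhiskerRight F.asEquivalence.unitIso.symm V.as)⟩

variable {K} (H : Subgroup K)

/-- The stabilizer of the coset of 1 is `H`, and the action on the cosets is transitive. -/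
instance : (orbitIncl H).IsEquivalence where
  full := ⟨fun {x y} a => by
    have h := a.property
    change a.val • ((1 : K) : K ⧸ H) = ((1 : K) : K ⧸ H) at h
    rw [MulAction.Quotient.smul_coe, QuotientGroup.eq] at h
    have h' : a.val ∈ H := by simpa using h
    exact ⟨⟨a.val, h'⟩, rfl⟩⟩
  essSurj := ⟨fun x => by
    obtain ⟨x⟩ := x
    obtain ⟨g, rfl⟩ := QuotientGroup.mk_surjective x
    refine ⟨SingleObj.star H, ⟨Groupoid.isoEquivHom _ _ |>.symm ⟨g, ?_⟩⟩⟩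
    change g • ((1 : K) : K ⧸ H) = _
    rw [MulAction.Quotient.smul_coe, smul_eq_mul, mul_one]⟩

lemma orbitPic_bijective : Function.Bijective (orbitPic k H) :=
  Pic.map_stRes_bijective k (orbitIncl H)

instance : Subsingleton (orbit (⊤ : Subgroup K)).carrier :=
  QuotientGroup.subsingleton_quotient_top

variable (K) in
/-- The functor from the one-object groupoid of a group to the action groupoid of a point. -/
def pointIncl : SingleObj K ⥤ ActionGroupoid (orbit (⊤ : Subgroup K)) where
  obj _ := ⟨((1 : K) : K ⧸ (⊤ : Subgroup K))⟩
  map g := ⟨g, Subsingleton.elim _ _⟩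
  map_id _ := rfl
  map_comp _ _ := rfl

instance : (pointIncl K).IsEquivalence where
  faithful := ⟨fun h => congrArg Subtype.val h⟩
  full := ⟨fun a => ⟨a.val, rfl⟩⟩
  essSurj := ⟨fun _ => ⟨SingleObj.star K,
    ⟨Groupoid.isoEquivHom _ _ |>.symm ⟨1, Subsingleton.elim _ _⟩⟩⟩⟩

lemma incl_res (t : EndoT k K) :
    EndoT.incl k H (EndoT.res k H t) = Pic.map (stRes k (subIncl H)) (EndoT.incl k K t) := by
  obtain ⟨V, hV⟩ := Pic.exists_rep t
  ext
  rw [EndoT.incl, EndoT.res, Pic.map_val _ _ (Pic.map_val _ _ hV), EndoT.incl,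
    Pic.map_val _ _ (Pic.map_val _ _ hV)]
  rfl

/-- Both routes restrict along the same functor from the one-object groupoid of `H` to the action
groupoid of the point. -/
lemma orbitPic_map_orbitProj
    (v : (stPic k K).obj (Opposite.op (orbit (⊤ : Subgroup K)))) :
    orbitPic k H (((stPic k K).map (orbitProj H).op).hom v) =
      Pic.map (stRes k (subIncl H)) (Pic.map (stRes k (pointIncl K)) v) := by
  obtain ⟨V, hV⟩ := Pic.exists_rep (show Pic (StRep k (orbit (⊤ : Subgroup K))) from v)
  ext
  refine (Pic.map_val _ _ (Pic.map_val _ _ hV)).trans ?_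
  refine Eq.trans ?_ (Pic.map_val _ _ (Pic.map_val _ _ hV)).symm
  rfl

/-- The Picard group of the stable category of `G/H` is the group of endotrivial modules of `H`. -/
noncomputable def orbitPicEquiv :
    (stPic k K).obj (Opposite.op (orbit H)) ≃* EndoT k H :=
  (MulEquiv.ofBijective _ (orbitPic_bijective k H)).trans
    (MulEquiv.ofBijective _ (EndoT.incl_bijective k H)).symm

lemma incl_orbitPicEquiv (w : (stPic k K).obj (Opposite.op (orbit H))) :
    EndoT.incl k H (orbitPicEquiv k H w) = orbitPic k H w :=
  (MulEquiv.ofBijective _ (EndoT.incl_bijective k H)).apply_symm_apply _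

lemma map_range_orbitPicEquiv :
    ((stPic k K).map (orbitProj H).op).hom.range.map (orbitPicEquiv k H).toMonoidHom =
      (EndoT.res k H).range := by
  ext t
  constructor
  · rintro ⟨_, ⟨v, rfl⟩, rfl⟩
    obtain ⟨s, hs⟩ := (EndoT.incl_bijective k K).2 (Pic.map (stRes k (pointIncl K)) v)
    refine ⟨s, (EndoT.incl_bijective k H).1 ?_⟩
    rw [incl_res, hs, ← orbitPic_map_orbitProj]
    exact (incl_orbitPicEquiv k H _).symm
  · rintro ⟨s, rfl⟩
    obtain ⟨v, hv⟩ := (Pic.map_stRes_bijective k (pointIncl K)).2 (EndoT.incl k K s)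
    refine ⟨_, ⟨v, rfl⟩, (EndoT.incl_bijective k H).1 ?_⟩
    refine (incl_orbitPicEquiv k H _).trans ?_
    refine (orbitPic_map_orbitProj k H v).trans ?_
    rw [incl_res, ← hv]

end Endotrivial
end StackRep

namespace StackRep
-- From a morphism over the fibre square to a coaction
section Coaction

variable {k : Type u} [Field k] {G : Type v} [Group G] {U X : FinGSet.{v} G} (α : U ⟶ X)

/-- A point of the fibre square. -/
def fibPair (u : U.carrier) (y : Fib α (FinGSet.toMap α u)) : (fiberPower α 1).carrier :=
  ⟨![u, y.val], by
    have := y.property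
    intro i j; fin_cases i <;> fin_cases j <;> simp [this]⟩

/-- A point of the triple fibre power. -/
def fibTriple (u : U.carrier) (y : Fib α (FinGSet.toMap α u))
    (z : Fib α (FinGSet.toMap α y.val)) : (fiberPower α 2).carrier :=
  ⟨![u, y.val, z.val], by
    have h := y.property
    have h' := z.property
    intro i j; fin_cases i <;> fin_cases j <;> simp [h, h']⟩

lemma smul_fibPair {u u' : ActionGroupoid U} (a : u ⟶ u') {y : Fib α (FinGSet.toMap α u.pt)}
    {y' : Fib α (FinGSet.toMap α u'.pt)} (h : a.val • y.val = y'.val) :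
    a.val • fibPair α u.pt y = fibPair α u'.pt y' := by
  refine Subtype.ext (funext fun i => ?_)
  fin_cases i
  · exact a.property
  · exact h

lemma smul_fibTriple {u u' : ActionGroupoid U} (a : u ⟶ u') {y : Fib α (FinGSet.toMap α u.pt)}
    {y' : Fib α (FinGSet.toMap α u'.pt)} (h : a.val • y.val = y'.val)
    {z : Fib α (FinGSet.toMap α y.val)} {z' : Fib α (FinGSet.toMap α y'.val)}
    (h' : a.val • z.val = z'.val) :
    a.val • fibTriple α u.pt y z = fibTriple α u'.pt y' z' := by
  refine Subtype.ext (funext fun i => ?_)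
  fin_cases i
  · exact a.property
  · exact h
  · exact h'

variable {α} {W : Rp k (ActionGroupoid U)}

/-- Equal points are joined by the morphism `1 : G`; naturality along it replaces rewriting in
dependent types. -/
lemma app_eq_of_eq {Y : FinGSet.{v} G} {A B : Rp k (ActionGroupoid Y)} (f : A ⟶ B)
    {q q' : Y.carrier} (h : q = q') :
    A.map (agHom (x := ⟨q⟩) (y := ⟨q'⟩) 1 ((one_smul G q).trans h)) ≫ f.app ⟨q'⟩ =
      f.app ⟨q⟩ ≫ B.map (agHom (x := ⟨q⟩) (y := ⟨q'⟩) 1 ((one_smul G q).trans h)) :=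
  f.naturality _

/-- The coaction defined by a morphism over the fibre square. -/
noncomputable def coact
    (x : (res k (factor α (0 : Fin 2))).obj W ⟶ (res k (factor α (1 : Fin 2))).obj W) :
    W ⟶ (res k α).obj ((push α).obj W) where
  app u := pushLift α W ((actionMap α).obj u) fun y => x.app ⟨fibPair α u.pt y⟩
  naturality u u' a := push_hom_ext fun y' => by
    obtain ⟨y, h⟩ := Fib.exists_translate α ((actionMap α).map a) y'
    refine (Category.assoc _ _ _).trans ?_
    refine (congrArg (_ ≫ ·) (pushLift_π _ _ _ _ _)).trans ?_
    refine Eq.trans ?_ (Category.assoc _ _ _).symm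
    refine Eq.trans ?_ (congrArg (_ ≫ ·) (push_obj_map_π α W _ _ _ h)).symm
    refine Eq.trans ?_ (pushLift_π_assoc _ _ _ _ _ _).symm
    exact x.naturality (agHom (x := ⟨fibPair α u.pt y⟩) (y := ⟨fibPair α u'.pt y'⟩) a.val
      (smul_fibPair α a h))

variable (α W) in
/-- The comparison from the pushforward of the triple fibre power to the iterated pushforward. -/
noncomputable def tripleComparison :
    (push (factor α (0 : Fin 3))).obj ((res k (factor α (2 : Fin 3))).obj W) ⟶
      (res k α).obj ((push α).obj ((res k α).obj ((push α).obj W))) where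
  app u := pushLift α ((res k α).obj ((push α).obj W)) ((actionMap α).obj u) fun y =>
    pushLift α W ((actionMap α).obj ⟨y.val⟩) fun z =>
      pushπ (factor α (0 : Fin 3)) ((res k (factor α (2 : Fin 3))).obj W) u
        ⟨fibTriple α u.pt y z, rfl⟩
  naturality u u' a := push_hom_ext fun y' => by
    obtain ⟨y, h⟩ := Fib.exists_translate α ((actionMap α).map a) y'
    refine (Category.assoc _ _ _).trans ?_
    refine (congrArg (_ ≫ ·) (pushLift_π _ _ _ _ _)).trans ?_
    refine Eq.trans ?_ (Category.assoc _ _ _).symm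
    refine Eq.trans ?_ (congrArg (_ ≫ ·) (push_obj_map_π α _ _ _ _ h)).symm
    refine Eq.trans ?_ (pushLift_π_assoc _ _ _ _ _ _).symm
    refine push_hom_ext fun z' => ?_
    let b : (⟨y.val⟩ : ActionGroupoid U) ⟶ ⟨y'.val⟩ := agHom a.val h
    obtain ⟨z, h'⟩ := Fib.exists_translate α ((actionMap α).map b) z'
    refine (Category.assoc _ _ _).trans ?_
    refine (congrArg (_ ≫ ·) (pushLift_π _ _ _ _ _)).trans ?_
    refine Eq.trans ?_ (Category.assoc _ _ _).symm
    refine Eq.trans ?_ (congrArg (_ ≫ ·) (push_obj_map_π α W ((actionMap α).map b) _ _ h')).symm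
    refine Eq.trans ?_ (pushLift_π_assoc _ _ _ _ _ _).symm
    exact push_obj_map_π (factor α (0 : Fin 3)) _ a _ _ (smul_fibTriple α a h h')

/-- The morphism to the iterated pushforward defined by a morphism over the triple fibre power. -/
noncomputable def tripleCoact
    (f : (res k (factor α (0 : Fin 3))).obj W ⟶ (res k (factor α (2 : Fin 3))).obj W) :
    W ⟶ (res k α).obj ((push α).obj ((res k α).obj ((push α).obj W))) :=
  (pushUnit (factor α (0 : Fin 3))).app W ≫ (push (factor α (0 : Fin 3))).map f ≫
    tripleComparison α W

lemma tripleCoact_app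
    (f : (res k (factor α (0 : Fin 3))).obj W ⟶ (res k (factor α (2 : Fin 3))).obj W)
    (u : ActionGroupoid U) (y : Fib α (FinGSet.toMap α u.pt)) (z : Fib α (FinGSet.toMap α y.val)) :
    ((tripleCoact f).app u ≫ pushπ α ((res k α).obj ((push α).obj W)) ((actionMap α).obj u) y) ≫
      pushπ α W ((actionMap α).obj ⟨y.val⟩) z = f.app ⟨fibTriple α u.pt y z⟩ := by
  have h1 : (((tripleComparison α W).app u ≫
      pushπ α ((res k α).obj ((push α).obj W)) ((actionMap α).obj u) y) ≫
      pushπ α W ((actionMap α).obj ⟨y.val⟩) z) = pushπ _ _ u ⟨fibTriple α u.pt y z, rfl⟩ := by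
    refine (congrArg (· ≫ _) (pushLift_π _ _ _ _ _)).trans ?_
    exact pushLift_π _ _ _ _ _
  have h2 : (tripleCoact f).app u = ((pushUnit (factor α (0 : Fin 3))).app W).app u ≫
    ((push (factor α (0 : Fin 3))).map f).app u ≫ (tripleComparison α W).app u := rfl
  rw [h2]
  simp only [Category.assoc] at h1 ⊢
  refine (congrArg (_ ≫ _ ≫ ·) h1).trans ?_
  refine (congrArg (_ ≫ ·) (push_map_π _ _ _ _)).trans ?_
  refine (pushUnit_π_assoc _ _ _ _ _).trans ?_
  refine (congrArg (· ≫ _) (toFib_self _ W _)).trans ?_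
  exact Category.id_comp _

/-- The pullback to the triple fibre power, along the projection on two factors, of a morphism
over the fibre square. -/
def pullHom (x : (res k (factor α (0 : Fin 2))).obj W ⟶ (res k (factor α (1 : Fin 2))).obj W)
    (i j : Fin 3) : (res k (factor α i)).obj W ⟶ (res k (factor α j)).obj W :=
  (res k (fiberProj α ![i, j])).map x

variable (x : (res k (factor α (0 : Fin 2))).obj W ⟶ (res k (factor α (1 : Fin 2))).obj W)

lemma coact_app (u : ActionGroupoid U) (y : Fib α (FinGSet.toMap α u.pt)) :
    (coact x).app u ≫ pushπ α W ((actionMap α).obj u) y = x.app ⟨fibPair α u.pt y⟩ :=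
  pushLift_π _ _ _ _ _

lemma pullHom_app_zero_one (u : U.carrier) (y : Fib α (FinGSet.toMap α u))
    (z : Fib α (FinGSet.toMap α y.val)) :
    (pullHom x 0 1).app ⟨fibTriple α u y z⟩ = x.app ⟨fibPair α u y⟩ := by
  have h := app_eq_of_eq x (q := FinGSet.toMap (fiberProj α ![0, 1]) (fibTriple α u y z))
    (q' := fibPair α u y) (Subtype.ext (funext fun i => by fin_cases i <;> rfl))
  refine Eq.trans ?_ (h.symm.trans ?_)
  · exact ((congrArg (_ ≫ ·) (W.map_id ⟨y.val⟩)).trans (Category.comp_id _)).symm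
  · exact (congrArg (· ≫ _) (W.map_id ⟨u⟩)).trans (Category.id_comp _)

lemma pullHom_app_one_two (u : U.carrier) (y : Fib α (FinGSet.toMap α u))
    (z : Fib α (FinGSet.toMap α y.val)) :
    (pullHom x 1 2).app ⟨fibTriple α u y z⟩ = x.app ⟨fibPair α y.val z⟩ := by
  have h := app_eq_of_eq x (q := FinGSet.toMap (fiberProj α ![1, 2]) (fibTriple α u y z))
    (q' := fibPair α y.val z) (Subtype.ext (funext fun i => by fin_cases i <;> rfl))
  refine Eq.trans ?_ (h.symm.trans ?_)
  · exact ((congrArg (_ ≫ ·) (W.map_id ⟨z.val⟩)).trans (Category.comp_id _)).symm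
  · exact (congrArg (· ≫ _) (W.map_id ⟨y.val⟩)).trans (Category.id_comp _)

lemma pullHom_app_zero_two (u : U.carrier) (y : Fib α (FinGSet.toMap α u))
    (z : Fib α (FinGSet.toMap α y.val)) :
    (pullHom x 0 2).app ⟨fibTriple α u y z⟩ =
      x.app ⟨fibPair α u ⟨z.val, z.property.trans y.property⟩⟩ := by
  have h := app_eq_of_eq x (q := FinGSet.toMap (fiberProj α ![0, 2]) (fibTriple α u y z))
    (q' := fibPair α u ⟨z.val, z.property.trans y.property⟩)
    (Subtype.ext (funext fun i => by fin_cases i <;> rfl))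
  refine Eq.trans ?_ (h.symm.trans ?_)
  · exact ((congrArg (_ ≫ ·) (W.map_id ⟨z.val⟩)).trans (Category.comp_id _)).symm
  · exact (congrArg (· ≫ _) (W.map_id ⟨u⟩)).trans (Category.id_comp _)

lemma triple_hom_ext {u : ActionGroupoid U} {Z : ModuleCat.{u} k}
    {f g : Z ⟶ ((res k α).obj ((push α).obj ((res k α).obj ((push α).obj W)))).obj u}
    (h : ∀ y z, (f ≫ pushπ α ((res k α).obj ((push α).obj W)) ((actionMap α).obj u) y) ≫
      pushπ α W ((actionMap α).obj ⟨y.val⟩) z =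
      (g ≫ pushπ α ((res k α).obj ((push α).obj W)) ((actionMap α).obj u) y) ≫
      pushπ α W ((actionMap α).obj ⟨y.val⟩) z) : f = g :=
  push_hom_ext fun y => push_hom_ext fun z => h y z

/-- At a triple `(u, y, z)` the iterated coaction is `x` at `(u, y)` followed by `x` at `(y, z)`.
With `coact_comp_unit`, the two sides of coassociativity become `tripleCoact` of the two sides of
the cocycle condition. -/
lemma coact_comp_map :
    coact x ≫ (res k α).map ((push α).map (coact x)) =
      tripleCoact (pullHom x 0 1 ≫ pullHom x 1 2) := by
  ext u : 2
  refine triple_hom_ext fun y z => ?_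
  refine Eq.trans ?_ (tripleCoact_app _ u y z).symm
  have h1 : (coact x ≫ (res k α).map ((push α).map (coact x))).app u =
    (coact x).app u ≫ ((push α).map (coact x)).app ((actionMap α).obj u) := rfl
  rw [h1, Category.assoc]
  refine (congrArg (fun t => (_ ≫ t) ≫ _) (push_map_π α (coact x) _ _)).trans ?_
  refine (congrArg (· ≫ _) (Category.assoc _ _ _).symm).trans ?_
  refine (congrArg (fun t => (t ≫ _) ≫ _) (coact_app x u y)).trans ?_
  refine (Category.assoc _ _ _).trans ?_
  refine (congrArg (_ ≫ ·) (coact_app x ⟨y.val⟩ z)).trans ?_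
  exact (congrArg₂ (· ≫ ·) (pullHom_app_zero_one x u.pt y z) (pullHom_app_one_two x u.pt y z)).symm

lemma coact_comp_unit :
    coact x ≫ (res k α).map ((pushUnit α).app ((push α).obj W)) = tripleCoact (pullHom x 0 2) := by
  ext u : 2
  refine triple_hom_ext fun y z => ?_
  refine Eq.trans ?_ ((tripleCoact_app (pullHom x 0 2) u y z).trans
    (pullHom_app_zero_two x u.pt y z)).symm
  have h1 : (coact x ≫ (res k α).map ((pushUnit α).app ((push α).obj W))).app u =
    (coact x).app u ≫ ((pushUnit α).app ((push α).obj W)).app ((actionMap α).obj u) := rfl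
  rw [h1, Category.assoc]
  refine (congrArg (fun t => (_ ≫ t) ≫ _) (pushUnit_π α ((push α).obj W) ((actionMap α).obj u) y)).trans
    ?_
  refine (Category.assoc _ _ _).trans ?_
  refine (congrArg (_ ≫ ·) (push_obj_map_π α W _ ⟨z.val, z.property.trans y.property⟩ z
    (one_smul _ _))).trans ?_
  refine (congrArg (fun t => _ ≫ _ ≫ t) (W.map_id ⟨z.val⟩)).trans ?_
  refine (congrArg (_ ≫ ·) (Category.comp_id _)).trans ?_
  exact coact_app x u _

variable (α) in
/-- The diagonal of a fibre power. -/
def diag (n : ℕ) : U ⟶ fiberPower α n :=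
  show U.carrier →[G] (fiberPower α n).carrier from
  { toFun u := ⟨fun _ => u, fun _ _ => rfl⟩
    map_smul' _ _ := rfl }

/-- The restriction to the diagonal of a morphism over the fibre square. -/
def diagHom : W ⟶ W := (res k (diag α 1)).map x

/-- The counit selects the component at the pair `(u, u)`. -/
lemma coact_comp_counit : coact x ≫ (pushCounit α).app W = diagHom x := by
  ext u : 2
  refine (coact_app x u ⟨u.pt, rfl⟩).trans ?_
  have h := app_eq_of_eq x (q := FinGSet.toMap (diag α 1) u.pt)
    (q' := fibPair α u.pt ⟨u.pt, rfl⟩) (Subtype.ext (funext fun i => by fin_cases i <;> rfl))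
  refine Eq.trans ?_ (h.trans ?_)
  · exact ((congrArg (· ≫ _) (W.map_id u)).trans (Category.id_comp _)).symm
  · exact (congrArg (_ ≫ ·) (W.map_id u)).trans (Category.comp_id _)

end Coaction
end StackRep

namespace StackRep
-- Effective descent for finite-dimensional stable representations
section EffectiveDescent

variable {k : Type u} [Field k] {G : Type v} [Group G] {U X : FinGSet.{v} G} (α : U ⟶ X)

instance : Finite (ActionGroupoid X) :=
  Finite.of_injective ActionGroupoid.pt fun _ _ h => ActionGroupoid.ext h

lemma FinVal.push {W : Rp k (ActionGroupoid U)} (hW : FinVal k W) :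
    FinVal k ((push α).obj W) := fun x => by
  have : Fintype (Fib α x.pt) := Fintype.ofFinite _
  have : ∀ c, Module.Finite k (W.obj c) := hW
  let φ : ((StackRep.push α).obj W).obj x →ₗ[k] ∀ y : Fib α x.pt, W.obj ⟨y.val⟩ :=
    LinearMap.pi fun y => (pushπ α W x y).hom
  have : IsNoetherian k (∀ y : Fib α x.pt, W.obj ⟨y.val⟩) := isNoetherian_pi
  refine Module.Finite.of_injective φ fun a b h => ?_
  have h1 : ModuleCat.ofHom (LinearMap.toSpanSingleton k _ a) =
      ModuleCat.ofHom (LinearMap.toSpanSingleton k _ b) := push_hom_ext fun y => by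
    refine ModuleCat.hom_ext (LinearMap.ext_ring ?_)
    change (pushπ α W x y).hom ((1 : k) • a) = (pushπ α W x y).hom ((1 : k) • b)
    rw [one_smul, one_smul]
    exact congrFun h y
  have h2 := ConcreteCategory.congr_hom h1 (1 : k)
  change (1 : k) • a = (1 : k) • b at h2
  rwa [one_smul, one_smul] at h2

variable {α}

/-- A cocycle condition that holds only stably cannot be checked at points. It passes to the
coaction because `tripleCoact` is built from the functor `push`, which respects stable equality. -/
lemma tripleCoact_stable {W : Rp k (ActionGroupoid U)}
    {f g : (res k (factor α (0 : Fin 3))).obj W ⟶ (res k (factor α (2 : Fin 3))).obj W}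
    (h : (toStable _).map f = (toStable _).map g) :
    (toStable _).map (tripleCoact f) = (toStable _).map (tripleCoact g) := by
  have h1 := congrArg (stableMap (push (k := k) (factor α (0 : Fin 3)))).map h
  have h2 : (toStable _).map ((push (k := k) (factor α (0 : Fin 3))).map f) =
    (toStable _).map ((push (k := k) (factor α (0 : Fin 3))).map g) := h1
  simp only [tripleCoact, Functor.map_comp, h2]

variable [Finite G]

lemma pullTo_inv {W : StRep k U} (ξ : Gluing k α W)
    (x : (res k (factor α (0 : Fin 2))).obj W.as ⟶ (res k (factor α (1 : Fin 2))).obj W.as)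
    (hx : (toStable _).map x = ξ.inv) (i j : Fin 3) :
    (ξ.pullTo i j).inv = (toStable _).map (pullHom x i j) := by
  have h1 : (ξ.pullTo i j).inv =
      𝟙 ((pull k (factor α i)).obj W) ≫ (pull k (fiberProj α ![i, j])).map ξ.inv ≫
        𝟙 ((pull k (factor α j)).obj W) := rfl
  refine h1.trans ((Category.id_comp _).trans ((Category.comp_id _).trans ?_))
  rw [← hx]
  rfl

/-- On the triple diagonal the cocycle condition says that the restricted gluing is idempotent;
being invertible, it is the identity. -/
lemma diagHom_stable {W : StRep k U} (ξ : Gluing k α W)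
    (x : (res k (factor α (0 : Fin 2))).obj W.as ⟶ (res k (factor α (1 : Fin 2))).obj W.as)
    (hx : (toStable _).map x = ξ.inv)
    (h : (toStable _).map (pullHom x 0 1 ≫ pullHom x 1 2) = (toStable _).map (pullHom x 0 2)) :
    (toStable _).map (diagHom x) = 𝟙 W := by
  let δ : W ≅ W := ((pull k (diag α 1)).mapIso ξ).symm
  have h1 : δ.hom = (toStable _).map (diagHom x) := by
    have : δ.hom = (pull k (diag α 1)).map ξ.inv := rfl
    rw [this, ← hx]
    rfl
  have h2 : δ.hom ≫ δ.hom = δ.hom := by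
    rw [h1]
    exact congrArg (pull k (diag α 2)).map h
  rw [← h1]
  exact (cancel_epi δ.hom).1 (h2.trans (Category.comp_id _).symm)

lemma exists_descent {n : ℕ} (hn : (n : k) ≠ 0) (hα : ∀ x, Nat.card (Fib α x) = n)
    {W : Rp k (ActionGroupoid U)} (hW : FinVal k W) (ξ : Gluing k α ((toStable _).obj W))
    (hξ : ξ.defect = Iso.refl _) :
    ∃ V : Rp k (ActionGroupoid X), FinVal k V ∧
      Nonempty ((pull k α).obj ((toStable _).obj V) ≅ (toStable _).obj W) := by
  -- The coaction maps the value at `u` to the values at the other points of its fibre, so the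
  -- morphism needed goes from `pr_1^*` to `pr_2^*`, which is the direction of `ξ.inv`.
  obtain ⟨x, hx⟩ := (toStable _).map_surjective
    (X := (res k (factor α (0 : Fin 2))).obj W) (Y := (res k (factor α (1 : Fin 2))).obj W) ξ.inv
  have h0 : (toStable _).map (pullHom x 0 1 ≫ pullHom x 1 2) =
      (toStable _).map (pullHom x 0 2) := by
    have h1 := congrArg Iso.inv hξ
    have h2 : (ξ.pullTo 0 2).hom ≫ (ξ.pullTo 0 1).inv ≫ (ξ.pullTo 1 2).inv = 𝟙 _ := by
      simpa [Gluing.defect] using h1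
    rw [Functor.map_comp, ← pullTo_inv ξ x hx, ← pullTo_inv ξ x hx, ← pullTo_inv ξ x hx]
    rw [← cancel_epi (ξ.pullTo 0 2).hom, h2, Iso.hom_inv_id]
  let ρ := (toStable _).map (coact x)
  let adj := stableAdj (resPushAdj (k := k) α)
  let s := stableToId (averagedTrace k α n)
  have hs (V : StRep k X) : adj.unit.app V ≫ s.app V = 𝟙 V :=
    congrArg (toStable _).map (pushUnit_averagedTrace k α hn hα V.as)
  have h1 : ρ ≫ adj.counit.app ((toStable _).obj W) = 𝟙 _ :=
    (congrArg (toStable _).map (coact_comp_counit x)).trans (diagHom_stable ξ x hx h0)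
  have h2 : ρ ≫ (pull k α).map ((stableMap (push α)).map ρ) =
      ρ ≫ (pull k α).map (adj.unit.app ((stableMap (push α)).obj ((toStable _).obj W))) :=
    ((congrArg (toStable _).map (coact_comp_map x)).trans (tripleCoact_stable h0)).trans
      (congrArg (toStable _).map (coact_comp_unit x)).symm
  -- The lift `e` is idempotent only stably; it splits because the pushforward of `W` is
  -- finite-dimensional.
  obtain ⟨e, he⟩ := (toStable _).map_surjective (X := (push α).obj W) (Y := (push α).obj W)
    ((stableMap (push α)).map ρ ≫ s.app ((stableMap (push α)).obj ((toStable _).obj W)))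
  obtain ⟨V, i, r, hV, hir, hri⟩ := (hW.push α).exists_split e (by
    rw [Functor.map_comp, he]
    exact coaction_averaging_idem adj s ρ hs h2)
  refine ⟨V, hV, nonempty_iso_of_coaction adj s ρ hs h2 h1 ((toStable _).map r)
    ((toStable _).map i) (congrArg (toStable _).map hir) ?_⟩
  rw [← Functor.map_comp, hri, he]

lemma pull_reflectsIsomorphisms {n : ℕ} (hn : (n : k) ≠ 0) (hα : ∀ x, Nat.card (Fib α x) = n) :
    (pull k α).ReflectsIsomorphisms where
  reflects f _ := isIso_of_isIso_map (stableAdj (resPushAdj (k := k) α))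
    (stableToId (averagedTrace k α n))
    (fun V => congrArg (toStable _).map (pushUnit_averagedTrace k α hn hα V.as)) f

lemma FinVal.tensorInvertible_of_pull {n : ℕ} (hn : (n : k) ≠ 0)
    (hα : ∀ x, Nat.card (Fib α x) = n) {V : Rp k (ActionGroupoid X)} (hV : FinVal k V)
    (h : TensorInvertible ((pull k α).obj ((toStable _).obj V))) :
    TensorInvertible ((toStable _).obj V) := by
  obtain ⟨V', ⟨hV'⟩⟩ := hV.exists_exactPairing
  have := pull_reflectsIsomorphisms hn hα
  have := exactPairingMap (toStable _) V V'
  exact tensorInvertible_of_map (V' := (toStable _).obj V') (pull k α) h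

end EffectiveDescent
end StackRep

namespace StackRep
-- Čech cochains in low degrees
section CechAlgebra

variable {G : Type v} [Group G] {U X : FinGSet.{v} G} (P : (FinGSet.{v} G)ᵒᵖ ⥤ CommGrpCat.{w})
  (α : U ⟶ X)

lemma mem_cechH0_iff {w : P.obj (Opposite.op U)} : w ∈ cechH0 P α ↔
    (P.map (factor α (0 : Fin 2)).op).hom w = (P.map (factor α (1 : Fin 2)).op).hom w := by
  rw [cechH0, MonoidHom.mem_ker, MonoidHom.div_apply, div_eq_one]

lemma factor_comp (n : ℕ) (i j : Fin (n + 1)) : factor α i ≫ α = factor α j ≫ α :=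
  MulActionHom.ext fun u => u.property i j

lemma map_mem_cechH0 (v : P.obj (Opposite.op X)) : (P.map α.op).hom v ∈ cechH0 P α := by
  rw [mem_cechH0_iff]
  have h : P.map α.op ≫ P.map (factor α (0 : Fin 2)).op =
      P.map α.op ≫ P.map (factor α (1 : Fin 2)).op := by
    rw [← P.map_comp, ← P.map_comp, ← op_comp, ← op_comp, factor_comp α 1 0 1]
  exact ConcreteCategory.congr_hom h v

lemma cechD_apply (n : ℕ) (c : CechCochain P α n) :
    cechD P α n c = ∏ i : Fin (n + 2),
      ((P.map (fiberProj α i.succAbove).op).hom c) ^ ((-1 : ℤ) ^ (i : ℕ)) := by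
  rw [cechD, MonoidHom.finsetProd_apply]
  rfl

lemma cechD_one_apply (c : CechCochain P α 1) :
    cechD P α 1 c = (P.map (fiberProj α ![1, 2]).op).hom c *
      ((P.map (fiberProj α ![0, 2]).op).hom c)⁻¹ *
      (P.map (fiberProj α ![0, 1]).op).hom c := by
  rw [cechD_apply, Fin.prod_univ_three]
  have h0 : (0 : Fin 3).succAbove = ![1, 2] := by decide
  have h1 : (1 : Fin 3).succAbove = ![0, 2] := by decide
  have h2 : (2 : Fin 3).succAbove = ![0, 1] := by decide
  simp [h0, h1, h2]

/-- The form without inverses is the one produced by comparing two evaluations of a composite in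
`unit_mul_eq_of_gluing`. -/
lemma mem_ker_cechD_two_iff (c : CechCochain P α 2) : c ∈ (cechD P α 2).ker ↔
    (P.map (fiberProj α (Fin.succAbove 0)).op).hom c *
      (P.map (fiberProj α (Fin.succAbove 2)).op).hom c =
    (P.map (fiberProj α (Fin.succAbove 3)).op).hom c *
      (P.map (fiberProj α (Fin.succAbove 1)).op).hom c := by
  rw [MonoidHom.mem_ker, cechD_apply, Fin.prod_univ_four]
  generalize (P.map (fiberProj α (Fin.succAbove 0)).op).hom c = a
  generalize (P.map (fiberProj α (Fin.succAbove 1)).op).hom c = b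
  generalize (P.map (fiberProj α (Fin.succAbove 2)).op).hom c = d
  generalize (P.map (fiberProj α (Fin.succAbove 3)).op).hom c = e
  have h : a ^ ((-1 : ℤ) ^ ((0 : Fin 4) : ℕ)) * b ^ ((-1 : ℤ) ^ ((1 : Fin 4) : ℕ)) *
      d ^ ((-1 : ℤ) ^ ((2 : Fin 4) : ℕ)) * e ^ ((-1 : ℤ) ^ ((3 : Fin 4) : ℕ)) =
      (a * d) * (e * b)⁻¹ := by
    have h3 : ((3 : Fin 4) : ℕ) = 3 := rfl
    have h4 : (-1 : ℤ) ^ 3 = -1 := rfl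
    simp only [Fin.val_zero, Fin.val_one, Fin.val_two, h3, h4, pow_zero, pow_one, neg_one_sq,
      zpow_one, zpow_neg, mul_inv]
    rw [mul_right_comm a, mul_assoc (a * d), mul_comm b⁻¹]
  rw [h, mul_inv_eq_one]

end CechAlgebra

/-! ### Pullbacks of gluings, the cocycle property and change of gluing -/

section Gluing

variable {k : Type u} [Field k] {G : Type v} [Group G] [Finite G] {U X : FinGSet.{v} G} {α : U ⟶ X}

/-- The pullback of a gluing along a map to the fibre square with components `a` and `b`. -/
noncomputable def Gluing.along {W : StRep k U} (ξ : Gluing k α W) {Z : FinGSet.{v} G}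
    (β : Z ⟶ fiberPower α 1) (a b : Z ⟶ U) (ha : β ≫ factor α 0 = a) (hb : β ≫ factor α 1 = b) :
    (pull k b).obj W ≅ (pull k a).obj W :=
  (pullTrans k β (factor α 1) b hb W).symm ≪≫ (pull k β).mapIso ξ ≪≫
    pullTrans k β (factor α 0) a ha W

lemma Gluing.along_congr {W : StRep k U} (ξ : Gluing k α W) {Z : FinGSet.{v} G}
    {β β' : Z ⟶ fiberPower α 1} (h : β = β') (a b : Z ⟶ U) (ha : β ≫ factor α 0 = a)
    (hb : β ≫ factor α 1 = b) (ha' : β' ≫ factor α 0 = a) (hb' : β' ≫ factor α 1 = b) :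
    ξ.along β a b ha hb = ξ.along β' a b ha' hb' := by
  subst h; rfl

lemma Gluing.along_hom {W : StRep k U} (ξ : Gluing k α W) {Z : FinGSet.{v} G}
    (β : Z ⟶ fiberPower α 1) :
    (ξ.along β (β ≫ factor α 0) (β ≫ factor α 1) rfl rfl).hom = (pull k β).map ξ.hom := by
  refine (Category.id_comp _).trans (Category.comp_id _)

/-- Keeping the components `a` and `b` as variables lets substitution remove the identifications;
what remains is strict functoriality of pullback. -/
lemma Gluing.pull_along {W : StRep k U} (ξ : Gluing k α W) {Z Z' : FinGSet.{v} G}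
    (β : Z ⟶ fiberPower α 1) (a b : Z ⟶ U) (ha : β ≫ factor α 0 = a) (hb : β ≫ factor α 1 = b)
    (γ : Z' ⟶ Z) :
    (pull k γ).map (ξ.along β a b ha hb).hom =
      (ξ.along (γ ≫ β) (γ ≫ a) (γ ≫ b) (by rw [Category.assoc, ha])
        (by rw [Category.assoc, hb])).hom := by
  subst ha hb
  rw [along_hom]
  refine Eq.trans ?_ (along_hom ξ (γ ≫ β)).symm
  obtain ⟨f, hf⟩ := (toStable _).map_surjective
    (X := (res k (factor α (1 : Fin 2))).obj W.as) (Y := (res k (factor α (0 : Fin 2))).obj W.as)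
    ξ.hom
  rw [← hf]
  rfl

/-- The pullback of a gluing along the projection of a fibre power on the factors `i` and `j`. -/
noncomputable def Gluing.at {W : StRep k U} (ξ : Gluing k α W) {n : ℕ} (i j : Fin (n + 1)) :
    (pull k (factor α j)).obj W ≅ (pull k (factor α i)).obj W :=
  ξ.along (fiberProj α ![i, j]) (factor α i) (factor α j) rfl rfl

lemma Gluing.pull_at {W : StRep k U} (ξ : Gluing k α W) {m n : ℕ} (s : Fin (m + 1) → Fin (n + 1))
    (i j : Fin (m + 1)) :
    (pull k (fiberProj α s)).map (ξ.at i j).hom = (ξ.at (s i) (s j)).hom := by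
  refine (ξ.pull_along _ _ _ rfl rfl (fiberProj α s)).trans ?_
  refine congrArg Iso.hom (ξ.along_congr
    (β := fiberProj α s ≫ fiberProj α ![i, j]) (β' := fiberProj α ![s i, s j]) ?_
    (factor α (s i)) (factor α (s j)) rfl rfl rfl rfl)
  change fiberProj α (s ∘ ![i, j]) = _
  congr 1
  funext l
  fin_cases l <;> rfl

/-- The unit of a presheaf value as an automorphism of the tensor unit. -/
abbrev asAut {Y : FinGSet.{v} G} (ζ : (unitsGm k G).obj (Opposite.op Y)) : Aut (𝟙_ (StRep k Y)) := ζ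

lemma isDefect_iff {W : StRep k U} (ξ : Gluing k α W) (ζ : CechCochain (unitsGm k G) α 2) :
    IsDefect ξ ζ ↔ (ξ.at (1 : Fin 3) 2).hom ≫ (ξ.at (0 : Fin 3) 1).hom =
      (unitAct (asAut ζ) ((pull k (factor α (2 : Fin 3))).obj W)).hom ≫
        (ξ.at (0 : Fin 3) 2).hom := by
  have h : ξ.defect.hom = ((ξ.at (1 : Fin 3) 2).hom ≫ (ξ.at (0 : Fin 3) 1).hom) ≫
    (ξ.at (0 : Fin 3) 2).inv := (Category.assoc _ _ _).symm
  rw [IsDefect, Iso.ext_iff, h, Iso.eq_comp_inv, eq_comm]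

lemma IsDefect.pullback {W : StRep k U} {ξ : Gluing k α W} {ζ : CechCochain (unitsGm k G) α 2}
    (h : IsDefect ξ ζ) {n : ℕ} (s : Fin 3 → Fin (n + 1)) :
    (ξ.at (s 1) (s 2)).hom ≫ (ξ.at (s 0) (s 1)).hom =
      (unitAct (asAut (((unitsGm k G).map (fiberProj α s).op).hom ζ))
        ((pull k (factor α (s 2))).obj W)).hom ≫ (ξ.at (s 0) (s 2)).hom := by
  have h1 := congrArg (pull k (fiberProj α s)).map ((isDefect_iff ξ ζ).1 h)
  rw [Functor.map_comp, Functor.map_comp, map_unitAct] at h1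
  refine Eq.trans (congrArg₂ (· ≫ ·) (ξ.pull_at s 1 2).symm (ξ.pull_at s 0 1).symm) (h1.trans ?_)
  exact congrArg (_ ≫ ·) (ξ.pull_at s 0 2)

section

variable {A : Type*} [Category* A] [MonoidalCategory A]

/-- The composite `M₃ → M₂ → M₁ → M₀` equals `e₀₃` up to the unit `a * c` or `d * b`, according to
which pair of arrows is contracted first. Invertibility of `M₃` then allows the units to be
compared. -/
lemma unit_mul_eq_of_gluing {M₀ M₁ M₂ M₃ : A} (h₃ : TensorInvertible M₃) (e₀₁ : M₁ ≅ M₀)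
    (e₀₂ : M₂ ≅ M₀) (e₁₂ : M₂ ≅ M₁) (e₀₃ : M₃ ≅ M₀) (e₁₃ : M₃ ≅ M₁) (e₂₃ : M₃ ≅ M₂)
    {a b c d : Aut (𝟙_ A)}
    (ha : e₂₃.hom ≫ e₁₂.hom = (unitAct a M₃).hom ≫ e₁₃.hom)
    (hb : e₂₃.hom ≫ e₀₂.hom = (unitAct b M₃).hom ≫ e₀₃.hom)
    (hc : e₁₃.hom ≫ e₀₁.hom = (unitAct c M₃).hom ≫ e₀₃.hom)
    (hd : e₁₂.hom ≫ e₀₁.hom = (unitAct d M₂).hom ≫ e₀₂.hom) : a * c = d * b := by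
  have h : (unitAct (c * a) M₃).hom ≫ e₀₃.hom = (unitAct (b * d) M₃).hom ≫ e₀₃.hom := by
    rw [unitAct_mul, unitAct_mul, Category.assoc, Category.assoc, ← hc, ← hb, ← reassoc_of% ha, hd,
      ← Category.assoc, ← Category.assoc, unitAct_naturality]
  rw [cancel_mono] at h
  rw [mul_comm a, mul_comm d]
  exact (unitAct_bijective h₃).1 (Iso.ext h)

/-- The maps `f` intertwine the two families only up to the units `a`, `b`, `c`. Collecting these
units changes the defect `z` by `a * b⁻¹ * c`, the shape of the Čech differential in degree one. -/
lemma gluing_conj {M₀ M₁ M₂ N₀ N₁ N₂ : A} (f₀ : M₀ ≅ N₀) (f₁ : M₁ ≅ N₁) (f₂ : M₂ ≅ N₂)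
    {e₀₁ : M₁ ≅ M₀} {e₀₂ : M₂ ≅ M₀} {e₁₂ : M₂ ≅ M₁} {e₀₁' : N₁ ≅ N₀}
    {e₀₂' : N₂ ≅ N₀} {e₁₂' : N₂ ≅ N₁} {a b c z : Aut (𝟙_ A)}
    (hc : f₁.hom ≫ e₀₁'.hom = (unitAct c M₁).hom ≫ e₀₁.hom ≫ f₀.hom)
    (hb : f₂.hom ≫ e₀₂'.hom = (unitAct b M₂).hom ≫ e₀₂.hom ≫ f₀.hom)
    (ha : f₂.hom ≫ e₁₂'.hom = (unitAct a M₂).hom ≫ e₁₂.hom ≫ f₁.hom)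
    (h : e₁₂.hom ≫ e₀₁.hom = (unitAct z M₂).hom ≫ e₀₂.hom) :
    e₁₂'.hom ≫ e₀₁'.hom = (unitAct (z * (a * b⁻¹ * c)) N₂).hom ≫ e₀₂'.hom := by
  have hz : z * (a * b⁻¹ * c) = b⁻¹ * (z * (c * a)) := by
    rw [mul_comm c, mul_left_comm b⁻¹, mul_right_comm a, mul_comm b⁻¹]
  have hb' : e₀₂.hom ≫ f₀.hom = (unitAct b⁻¹ M₂).hom ≫ f₂.hom ≫ e₀₂'.hom := by
    rw [hb, ← Category.assoc, ← unitAct_mul, mul_inv_cancel, unitAct_one, Category.id_comp]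
  rw [hz, ← cancel_epi f₂.hom, reassoc_of% ha, hc, ← unitAct_naturality_assoc, reassoc_of% h, hb',
    ← unitAct_naturality_assoc _ f₂.hom, unitAct_mul, unitAct_mul, unitAct_mul]
  simp only [Category.assoc]

end

lemma IsDefect.mem_ker {W : StRep k U} (hW : TensorInvertible W) {ξ : Gluing k α W}
    {ζ : CechCochain (unitsGm k G) α 2} (h : IsDefect ξ ζ) :
    ζ ∈ (cechD (unitsGm k G) α 2).ker := by
  rw [mem_ker_cechD_two_iff]
  have h0 : (ξ.at (2 : Fin 4) 3).hom ≫ (ξ.at (1 : Fin 4) 2).hom = _ ≫ (ξ.at (1 : Fin 4) 3).hom :=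
    h.pullback (Fin.succAbove 0)
  have h1 : (ξ.at (2 : Fin 4) 3).hom ≫ (ξ.at (0 : Fin 4) 2).hom = _ ≫ (ξ.at (0 : Fin 4) 3).hom :=
    h.pullback (Fin.succAbove 1)
  have h2 : (ξ.at (1 : Fin 4) 3).hom ≫ (ξ.at (0 : Fin 4) 1).hom = _ ≫ (ξ.at (0 : Fin 4) 3).hom :=
    h.pullback (Fin.succAbove 2)
  have h3 : (ξ.at (1 : Fin 4) 2).hom ≫ (ξ.at (0 : Fin 4) 1).hom = _ ≫ (ξ.at (0 : Fin 4) 2).hom :=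
    h.pullback (Fin.succAbove 3)
  exact unit_mul_eq_of_gluing (hW.map (pull k (factor α (3 : Fin 4)))) _ _ _ _ _ _ h0 h1 h2 h3

lemma Gluing.along_conj {W W' : StRep k U} (φ : W ≅ W') (ξ : Gluing k α W) (ξ' : Gluing k α W')
    (c : CechCochain (unitsGm k G) α 1)
    (h : (pull k (factor α (1 : Fin 2))).map φ.hom ≫ ξ'.hom =
      (unitAct (asAut c) _).hom ≫ ξ.hom ≫ (pull k (factor α (0 : Fin 2))).map φ.hom)
    {n : ℕ} (i j : Fin (n + 1)) :
    (pull k (factor α j)).map φ.hom ≫ (ξ'.at i j).hom =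
      (unitAct (asAut (((unitsGm k G).map (fiberProj α ![i, j]).op).hom c)) _).hom ≫
        (ξ.at i j).hom ≫ (pull k (factor α i)).map φ.hom := by
  have h1 := congrArg (pull k (fiberProj α ![i, j])).map h
  simp only [Functor.map_comp, map_unitAct] at h1
  have h2 (l : Fin 2) : (pull k (fiberProj α ![i, j])).map ((pull k (factor α l)).map φ.hom) =
      (pull k (fiberProj α ![i, j] ≫ factor α l)).map φ.hom := by
    obtain ⟨f, hf⟩ := (toStable _).map_surjective (X := W.as) (Y := W'.as) φ.hom
    rw [← hf]
    rfl
  have h3 : (ξ.at i j).hom = (pull k (fiberProj α ![i, j])).map ξ.hom := ξ.along_hom _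
  have h4 : (ξ'.at i j).hom = (pull k (fiberProj α ![i, j])).map ξ'.hom := ξ'.along_hom _
  rw [h3, h4]
  refine Eq.trans (congrArg (· ≫ _) (h2 1).symm) (h1.trans ?_)
  exact congrArg (_ ≫ _ ≫ ·) (h2 0)

lemma IsDefect.conj {W W' : StRep k U} (φ : W ≅ W') {ξ : Gluing k α W} {ξ' : Gluing k α W'}
    {c : CechCochain (unitsGm k G) α 1}
    (h : (pull k (factor α (1 : Fin 2))).map φ.hom ≫ ξ'.hom =
      (unitAct (asAut c) _).hom ≫ ξ.hom ≫ (pull k (factor α (0 : Fin 2))).map φ.hom)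
    {ζ : CechCochain (unitsGm k G) α 2} (hζ : IsDefect ξ ζ) :
    IsDefect ξ' (ζ * cechD (unitsGm k G) α 1 c) := by
  have h12 := Gluing.along_conj φ ξ ξ' c h (1 : Fin 3) 2
  have h02 := Gluing.along_conj φ ξ ξ' c h (0 : Fin 3) 2
  have h01 := Gluing.along_conj φ ξ ξ' c h (0 : Fin 3) 1
  rw [isDefect_iff] at hζ ⊢
  rw [cechD_one_apply]
  exact gluing_conj ((pull k (factor α (0 : Fin 3))).mapIso φ)
    ((pull k (factor α (1 : Fin 3))).mapIso φ) ((pull k (factor α (2 : Fin 3))).mapIso φ)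
    h01 h02 h12 hζ

end Gluing
end StackRep

namespace StackRep
-- Independence of choices, products and restricted objects
section ObstructionClass

variable {k : Type u} [Field k] {G : Type v} [Group G] [Finite G] {U X : FinGSet.{v} G} {α : U ⟶ X}

lemma HasClass.tensorInvertible {Y : FinGSet.{v} G} {w : (stPic k G).obj (Opposite.op Y)}
    {W : StRep k Y} (h : HasClass k w W) : TensorInvertible W :=
  Pic.tensorInvertible h

lemma HasClass.nonempty_iso {Y : FinGSet.{v} G} {w : (stPic k G).obj (Opposite.op Y)}
    {W W' : StRep k Y} (h : HasClass k w W) (h' : HasClass k w W') : Nonempty (W ≅ W') :=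
  toSkeleton_eq_toSkeleton_iff.1 (Eq.trans (Eq.symm h) h')

lemma HasClass.map {Y Z : FinGSet.{v} G} {w : (stPic k G).obj (Opposite.op Y)}
    {W : StRep k Y} (h : HasClass k w W) (β : Z ⟶ Y) :
    HasClass k (((stPic k G).map β.op).hom w) ((pull k β).obj W) :=
  Pic.map_val (pull k β) _ h

lemma exists_hasClass {Y : FinGSet.{v} G} (w : (stPic k G).obj (Opposite.op Y)) :
    ∃ W, HasClass k w W := Pic.exists_rep _

lemma nonempty_gluing {w : (stPic k G).obj (Opposite.op U)} (hw : w ∈ cechH0 (stPic k G) α)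
    {W : StRep k U} (h : HasClass k w W) : Nonempty (Gluing k α W) := by
  rw [mem_cechH0_iff] at hw
  have h0 := h.map (factor α (0 : Fin 2))
  have h1 := h.map (factor α (1 : Fin 2))
  rw [hw] at h0
  exact h1.nonempty_iso h0

lemma existsUnique_isDefect {W : StRep k U} (hW : TensorInvertible W) (ξ : Gluing k α W) :
    ∃! ζ, IsDefect ξ ζ :=
  (unitAct_bijective (hW.map (pull k (factor α (2 : Fin 3))))).existsUnique ξ.defect

lemma IsDefect.unique {W : StRep k U} (hW : TensorInvertible W) {ξ : Gluing k α W} {ζ ζ'}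
    (h : IsDefect ξ ζ) (h' : IsDefect ξ ζ') : ζ = ζ' :=
  (existsUnique_isDefect hW ξ).unique h h'

/-- The failure of `φ` to commute with the gluings is an automorphism of the invertible object
`pr_2^* W`, hence a unit `c` on the fibre square. -/
lemma exists_coboundary {W W' : StRep k U} (hW : TensorInvertible W) (φ : W ≅ W')
    (ξ : Gluing k α W) (ξ' : Gluing k α W') {ζ ζ'} (h : IsDefect ξ ζ) (h' : IsDefect ξ' ζ') :
    ∃ c, ζ' = ζ * cechD (unitsGm k G) α 1 c := by
  obtain ⟨c, hc⟩ := (unitAct_bijective (hW.map (pull k (factor α (1 : Fin 2))))).2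
    ((pull k (factor α (1 : Fin 2))).mapIso φ ≪≫ ξ' ≪≫
      (pull k (factor α (0 : Fin 2))).mapIso φ.symm ≪≫ ξ.symm)
  refine ⟨c, h'.unique (hW.of_iso φ) (h.conj φ ?_)⟩
  have h1 := congrArg Iso.hom hc
  refine Eq.trans ?_ (congrArg (· ≫ _) h1.symm)
  simp [← Functor.map_comp]

/-- The tensor product of gluings. -/
noncomputable def Gluing.tensor {W W' : StRep k U} (ξ : Gluing k α W) (ξ' : Gluing k α W') :
    Gluing k α (W ⊗ W') :=
  (Functor.Monoidal.μIso (pull k (factor α (1 : Fin 2))) W W').symm ≪≫ (ξ ⊗ᵢ ξ') ≪≫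
    Functor.Monoidal.μIso (pull k (factor α (0 : Fin 2))) W W'

lemma Gluing.tensor_at {W W' : StRep k U} (ξ : Gluing k α W) (ξ' : Gluing k α W') {n : ℕ}
    (i j : Fin (n + 1)) :
    ((ξ.tensor ξ').at i j).hom = (ξ.at i j).hom ⊗ₘ (ξ'.at i j).hom := by
  obtain ⟨f, hf⟩ := (toStable _).map_surjective
    (X := (res k (factor α (1 : Fin 2))).obj W.as) (Y := (res k (factor α (0 : Fin 2))).obj W.as)
    ξ.hom
  obtain ⟨f', hf'⟩ := (toStable _).map_surjective
    (X := (res k (factor α (1 : Fin 2))).obj W'.as) (Y := (res k (factor α (0 : Fin 2))).obj W'.as)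
    ξ'.hom
  have h1 : (ξ.at i j).hom = (pull k (fiberProj α ![i, j])).map ξ.hom := ξ.along_hom _
  have h2 : (ξ'.at i j).hom = (pull k (fiberProj α ![i, j])).map ξ'.hom := ξ'.along_hom _
  have h3 : ((ξ.tensor ξ').at i j).hom = (pull k (fiberProj α ![i, j])).map (ξ.tensor ξ').hom :=
    (ξ.tensor ξ').along_hom _
  have h4 : (ξ.tensor ξ').hom = 𝟙 _ ≫ (ξ.hom ⊗ₘ ξ'.hom) ≫ 𝟙 _ := rfl
  rw [h1, h2, h3, h4, ← hf, ← hf']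
  refine (congrArg (pull k (fiberProj α ![i, j])).map
    ((Category.id_comp _).trans (Category.comp_id _))).trans ?_
  rfl

lemma gluing_tensor {A : Type*} [Category* A] [MonoidalCategory A] [BraidedCategory A]
    {M₀ M₁ M₂ N₀ N₁ N₂ : A}
    {e₀₁ : M₁ ⟶ M₀} {e₀₂ : M₂ ⟶ M₀} {e₁₂ : M₂ ⟶ M₁} {e₀₁' : N₁ ⟶ N₀}
    {e₀₂' : N₂ ⟶ N₀} {e₁₂' : N₂ ⟶ N₁} {z z' : Aut (𝟙_ A)}
    (h : e₁₂ ≫ e₀₁ = (unitAct z M₂).hom ≫ e₀₂) (h' : e₁₂' ≫ e₀₁' = (unitAct z' N₂).hom ≫ e₀₂') :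
    (e₁₂ ⊗ₘ e₁₂') ≫ (e₀₁ ⊗ₘ e₀₁') = (unitAct (z * z') (M₂ ⊗ N₂)).hom ≫ (e₀₂ ⊗ₘ e₀₂') := by
  rw [tensorHom_comp_tensorHom, h, h', ← tensorHom_comp_tensorHom, mul_comm, unitAct_mul,
    unitAct_tensor_left, unitAct_tensor_right, ← MonoidalCategory.tensorHom_def]

lemma IsDefect.tensor {W W' : StRep k U} {ξ : Gluing k α W} {ξ' : Gluing k α W'} {ζ ζ'}
    (h : IsDefect ξ ζ) (h' : IsDefect ξ' ζ') : IsDefect (ξ.tensor ξ') (ζ * ζ') := by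
  rw [isDefect_iff] at *
  rw [Gluing.tensor_at, Gluing.tensor_at, Gluing.tensor_at]
  exact gluing_tensor h h'

/-- The two pullbacks of `α^* V` are equal, and isomorphisms that come from equalities compose to
such isomorphisms. -/
lemma exists_gluing_pull (V : StRep k X) :
    ∃ ξ : Gluing k α ((pull k α).obj V), IsDefect ξ 1 := by
  let ξ : Gluing k α ((pull k α).obj V) :=
    pullTrans k (factor α (1 : Fin 2)) α (factor α (0 : Fin 2) ≫ α) (factor_comp α 1 1 0) V
  have hξ (i j : Fin 3) : (ξ.at i j).hom = eqToHom
      (congrArg (fun γ => (pull k γ).obj V) (factor_comp α 2 j i)) := by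
    refine (ξ.along_hom _).trans ?_
    exact eqToHom_map (pull k (fiberProj α ![i, j]))
      (congrArg (fun γ => (pull k γ).obj V) (factor_comp α 1 1 0))
  refine ⟨ξ, ?_⟩
  rw [isDefect_iff, hξ, hξ, hξ]
  refine Eq.trans ?_ ((congrArg (· ≫ _) (unitAct_one _)).trans (Category.id_comp _)).symm
  exact eqToHom_trans _ _

end ObstructionClass
end StackRep

namespace StackRep
-- The obstruction homomorphism and its kernel
section ObstructionHom

variable {k : Type u} [Field k] {G : Type v} [Group G] [Finite G] {H : Subgroup G}

lemma card_fib_orbitProj (x : (orbit (⊤ : Subgroup G)).carrier) :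
    Nat.card (Fib (orbitProj H) x) = H.index :=
  Nat.card_congr (Equiv.subtypeUnivEquiv fun _ => Subsingleton.elim _ _)

/-- The statement for `H` is carried over by the equivalence `orbitIncl H` and its quasi-inverse. -/
lemma exists_finVal_of_tensorInvertible_orbit {W : StRep k (orbit H)} (hW : TensorInvertible W) :
    ∃ Y : Rp k (ActionGroupoid (orbit H)), FinVal k Y ∧ Nonempty (W ≅ (toStable _).obj Y) := by
  obtain ⟨Y, hY, ⟨e⟩⟩ := exists_finVal_of_tensorInvertible _ (hW.map (stRes k (orbitIncl H)))
  refine ⟨(orbitIncl H).inv ⋙ Y, fun c => hY _, ⟨?_ ≪≫ (stRes k (orbitIncl H).inv).mapIso e⟩⟩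
  exact (toStable _).mapIso
    (Functor.isoWhiskerRight (orbitIncl H).asEquivalence.counitIso.symm W.as)

variable (k H) in
/-- The obstruction homomorphism exists. -/
lemma exists_isObstructionHom :
    ∃ z : PicH0 k H →* UnitsH2 k H, IsObstructionHom z := by
  have h (w : PicH0 k H) : ∃ (W : StRep k (orbit H)) (ξ : Gluing k (orbitProj H) W)
      (ζ : CechCochain (unitsGm k G) (orbitProj H) 2), HasClass k w.val W ∧ IsDefect ξ ζ := by
    obtain ⟨W, hW⟩ := exists_hasClass w.val
    obtain ⟨ξ⟩ := nonempty_gluing w.property hW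
    obtain ⟨ζ, hζ, -⟩ := existsUnique_isDefect hW.tensorInvertible ξ
    exact ⟨W, ξ, ζ, hW, hζ⟩
  choose W ξ ζ hW hζ using h
  let z (w : PicH0 k H) : UnitsH2 k H :=
    QuotientGroup.mk ⟨ζ w, (hζ w).mem_ker (hW w).tensorInvertible⟩
  have hz (w : PicH0 k H) (W' : StRep k (orbit H)) (hW' : HasClass k w.val W')
      (ξ' : Gluing k (orbitProj H) W') (ζ' : CechCochain (unitsGm k G) (orbitProj H) 2)
      (hζ' : IsDefect ξ' ζ') : ∃ hk : ζ' ∈ (cechD (unitsGm k G) (orbitProj H) 2).ker,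
        z w = QuotientGroup.mk ⟨ζ', hk⟩ := by
    refine ⟨hζ'.mem_ker hW'.tensorInvertible, QuotientGroup.eq.2 ?_⟩
    obtain ⟨φ⟩ := (hW w).nonempty_iso hW'
    obtain ⟨c, hc⟩ := exists_coboundary (hW w).tensorInvertible φ (ξ w) ξ' (hζ w) hζ'
    rw [Subgroup.mem_subgroupOf]
    refine ⟨c, ?_⟩
    change _ = (ζ w)⁻¹ * ζ'
    rw [hc, inv_mul_cancel_left]
  refine ⟨MonoidHom.mk' z fun w w' => ?_, hz⟩
  -- The tensor product need not be the representative chosen for `w * w'`; independence of choices,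
  -- in the form `hz`, bridges the gap.
  have hc : HasClass k (w * w').val (W w ⊗ W w') := by
    refine Eq.trans ?_ (Skeleton.toSkeleton_tensorObj _ _).symm
    exact congrArg₂ (· * ·) (hW w) (hW w')
  obtain ⟨_, h1⟩ := hz (w * w') _ hc _ _ ((hζ w).tensor (hζ w'))
  exact h1

lemma IsObstructionHom.unique {z z' : PicH0 k H →* UnitsH2 k H} (hz : IsObstructionHom z)
    (hz' : IsObstructionHom z') : z' = z := by
  ext w
  obtain ⟨W, hW⟩ := exists_hasClass w.val
  obtain ⟨ξ⟩ := nonempty_gluing w.property hW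
  obtain ⟨ζ, hζ, -⟩ := existsUnique_isDefect hW.tensorInvertible ξ
  obtain ⟨_, h⟩ := hz w W hW ξ ζ hζ
  obtain ⟨_, h'⟩ := hz' w W hW ξ ζ hζ
  exact h'.trans h.symm

/-- Rescaling `ξ` by `c⁻¹` multiplies its defect by the coboundary of `c⁻¹`. -/
lemma exists_gluing_defect_one {W : StRep k (orbit H)} (ξ : Gluing k (orbitProj H) W)
    (c : CechCochain (unitsGm k G) (orbitProj H) 1)
    (h : IsDefect ξ (cechD (unitsGm k G) (orbitProj H) 1 c)) :
    ∃ ξ' : Gluing k (orbitProj H) W, ξ'.defect = Iso.refl _ := by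
  let ξ' : Gluing k (orbitProj H) W := unitAct (asAut c⁻¹) _ ≪≫ ξ
  have h1 : IsDefect ξ' (cechD (unitsGm k G) (orbitProj H) 1 c *
      cechD (unitsGm k G) (orbitProj H) 1 c⁻¹) := by
    refine h.conj (Iso.refl W) ?_
    simp [ξ']
  rw [map_inv, mul_inv_cancel] at h1
  exact ⟨ξ', Eq.trans (Eq.symm h1) (Iso.ext (unitAct_one _))⟩

lemma IsObstructionHom.range_eq {z : PicH0 k H →* UnitsH2 k H} (hz : IsObstructionHom z)
    (hH : (H.index : k) ≠ 0) :
    ((stPic k G).map (orbitProj H).op).hom.range = z.ker.map (PicH0 k H).subtype := by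
  ext w
  constructor
  · rintro ⟨v, rfl⟩
    obtain ⟨V, hV⟩ := exists_hasClass v
    obtain ⟨ξ, hξ⟩ := exists_gluing_pull (α := orbitProj H) V
    obtain ⟨_, h⟩ := hz ⟨_, map_mem_cechH0 (stPic k G) (orbitProj H) v⟩ _ (hV.map _) ξ 1 hξ
    exact ⟨_, h, rfl⟩
  · rintro ⟨w, hw, rfl⟩
    obtain ⟨W, hW⟩ := exists_hasClass w.val
    -- A finite-dimensional representative is fixed before a gluing is chosen, as effective descent
    -- is available only for such objects.
    obtain ⟨Y, hY, ⟨e⟩⟩ := exists_finVal_of_tensorInvertible_orbit hW.tensorInvertible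
    have hWY : HasClass k w.val ((toStable _).obj Y) := Eq.trans hW (congr_toSkeleton_of_iso e)
    obtain ⟨ξ⟩ := nonempty_gluing w.property hWY
    obtain ⟨ζ, hζ, -⟩ := existsUnique_isDefect hWY.tensorInvertible ξ
    obtain ⟨hk, h⟩ := hz w _ hWY ξ ζ hζ
    have h1 : z w = 1 := hw
    rw [h1, eq_comm, QuotientGroup.eq_one_iff, Subgroup.mem_subgroupOf] at h
    obtain ⟨c, rfl⟩ := h
    obtain ⟨ξ', hξ'⟩ := exists_gluing_defect_one ξ c hζ
    obtain ⟨V, hV, ⟨f⟩⟩ := exists_descent hH card_fib_orbitProj hY ξ' hξ'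
    obtain ⟨v, hv⟩ := isUnit_toSkeleton_iff.2 (hV.tensorInvertible_of_pull hH card_fib_orbitProj
      (hWY.tensorInvertible.of_iso f.symm))
    have hv' : HasClass k (X := orbit (⊤ : Subgroup G)) v ((toStable _).obj V) := hv
    refine ⟨v, Units.ext ?_⟩
    exact (hv'.map (orbitProj H)).trans ((congr_toSkeleton_of_iso f).trans (Eq.symm hWY))

end ObstructionHom
end StackRep

theorem mainTheorem4 {k : Type u} [Field k] (p : ℕ) [Fact p.Prime] [CharP k p]
    {G : Type v} [Group G] [Finite G] (hG : p ∣ Nat.card G)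
    (H : Subgroup G) (hH : H.index.Coprime p) :
    -- (a) the image of restriction lies in `Ȟ⁰`
    (∀ v, ((stPic k G).map (orbitProj H).op).hom v ∈ PicH0 k H) ∧
    -- (b) every choice `(W, ξ)` exists and gives a unique unit `ζ`, which is a 2-cocycle ...
    (∀ w ∈ PicH0 k H, (∃ W, HasClass k w W) ∧
      ∀ W, HasClass k w W → Nonempty (Gluing k (orbitProj H) W) ∧
        ∀ ξ : Gluing k (orbitProj H) W, (∃! ζ, IsDefect ξ ζ) ∧
          ∀ ζ, IsDefect ξ ζ → ζ ∈ (cechD (unitsGm k G) (orbitProj H) 2).ker) ∧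
    -- ... whose cohomology class depends neither on `ξ` nor on `W`
    (∀ w ∈ PicH0 k H, ∀ W W', HasClass k w W → HasClass k w W' →
      ∀ (ξ : Gluing k (orbitProj H) W) (ξ' : Gluing k (orbitProj H) W') (ζ ζ'),
        IsDefect ξ ζ → IsDefect ξ' ζ' →
          ∃ c, ζ' = ζ * cechD (unitsGm k G) (orbitProj H) 1 c) ∧
    -- (c) the resulting well-defined homomorphism `z`
    ∃ z : PicH0 k H →* UnitsH2 k H, IsObstructionHom z ∧
      (∀ z' : PicH0 k H →* UnitsH2 k H, IsObstructionHom z' → z' = z) ∧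
      -- (d) the image of restriction is the kernel of `z`
      ((stPic k G).map (orbitProj H).op).hom.range = z.ker.map (PicH0 k H).subtype ∧
      -- (e) evaluation at the coset of `1` identifies the Picard group of `G/H` with `T(H)`, and
      -- `ker z` with the image of `T(G)`
      ∃ e : (stPic k G).obj (Opposite.op (orbit H)) ≃* EndoT k H,
        (∀ w, EndoT.incl k H (e w) = orbitPic k H w) ∧
        (z.ker.map (PicH0 k H).subtype).map e.toMonoidHom = (EndoT.res k H).range := by
  -- Coprimality of the index enters here: it permits dividing the trace by the number of points in
  -- a fibre.
  have hk : (H.index : k) ≠ 0 := by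
    rw [Ne, CharP.cast_eq_zero_iff k p]
    exact fun h => (Fact.out : p.Prime).one_lt.ne' (Nat.Coprime.eq_one_of_dvd hH.symm h)
  obtain ⟨z, hz⟩ := exists_isObstructionHom k H
  refine ⟨fun v => map_mem_cechH0 _ _ v, fun w hw => ⟨exists_hasClass w, fun W hW =>
    ⟨nonempty_gluing hw hW, fun ξ => ⟨existsUnique_isDefect hW.tensorInvertible ξ,
      fun ζ hζ => hζ.mem_ker hW.tensorInvertible⟩⟩⟩, fun w _ W W' hW hW' ξ ξ' ζ ζ' hζ hζ' => ?_,
    z, hz, fun z' hz' => hz.unique hz', hz.range_eq hk, orbitPicEquiv k H,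
    incl_orbitPicEquiv k H, ?_⟩
  · obtain ⟨φ⟩ := hW.nonempty_iso hW'
    exact exists_coboundary hW.tensorInvertible φ ξ ξ' hζ hζ'
  · rw [← hz.range_eq hk]
    exact map_range_orbitPicEquiv k H
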